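/- Let $\Omega=[0,1]\times\mathbb R$, $M(v)=(2\pi)^{-1/2}e^{-v^2/2}$, and $\|g\|_V^2=\int_\Omega g^2\,dx\,dv+\int_\Omega(\partial_xg)^2\,dx\,dv$; let $V$ be the space of $g\in L^2(\Omega)$ with weak derivative $\partial_xg\in L^2(\Omega)$. Let $\mathcal L g=M^{-1/2}\,\partial_v\big(M\,\partial_v(g/\sqrt M)\big)$. Let $0<\lambda\le\frac14$ and $0<C_s\le 1$ be constants. (These ranges contain $\lambda=\frac14$ and every constant $\lambda>0$ in the coercivity estimate $-\langle\mathcal Lg,g\rangle\ge\lambda\big(\|w\|^2+\|\partial_vw\|^2+\|vw\|^2\big)$, $w=g-\big(\int g\sqrt M\,dv\big)\sqrt M$, and every such $C_s$ satisfies the Poincaré inequality $\|\partial_x\sigma\|^2\ge\frac{C_s}{2}\big(\|\sigma-\int_0^1\sigma\,dx\|^2+\|\partial_x\sigma\|^2\big)$ for all $\sigma\in H^1(0,1)$.) Let $E:[0,\infty)\times[0,1]\to\mathbb R$ be of class $C^3$ in $x$ for each $t$, and let $C_E$ be such that for all $t\ge0$ $$\|E(t,\cdot)\|_{L^\infty},\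 \|\partial_xE(t,\cdot)\|_{L^\infty},\ \|\partial_x^3E(t,\cdot)\|_{L^\infty}\le\frac{C_E}{2}\le\frac{\lambda C_s}{16},\quad E(t,0)=E(t,1)=0,\quad \partial_x^2E(t,0)=\partial_x^2E(t,1).$$ Let $0<\epsilon\le1$, let $$\frac{4C_E}{3C_s-2C_E}<a<\frac{\lambda-C_E}{4},$$ and let $k_{00},k_{10},k_{01},k_{11}$ be arbitrary real numbers. Let $h=h(t,x,v)$ be a solution, for $t>0$, of $$\epsilon\,\partial_th+v\,\partial_xh-\frac1\epsilon\mathcal Lh=E\Big(\partial_v-\frac v2\Big)h,\qquad 0<x<1,\ v\in\mathbb R,$$ $$h(t,0,v)=k_{00}h(t,0,-v)+k_{10}h(t,1,v)\ (v>0),\qquad h(t,1,v)=k_{01}h(t,0,v)+k_{11}h(t,1,-v)\ (v<0),$$ with initial datum $h_0=f_0/\sqrt M\in V$, where $\int_\Omega f_0\,dx\,dv=0$ and $h(t)\to h_0$ in $V$ as $t\downarrow0$. Here $h$ is a strong solution: it is $C^2$ on $(0,\infty)\times[0,1]\times\mathbb R$ and for all $0<\tau<T$ there is $B\in L^2(\mathbb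 R)$ such that $(1+|v|)|h|$, $(1+|v|)|\partial_xh|$, $|\partial_vh|$, $|\partial_th|$, $|\partial_x^2h|$, $|\partial_x\partial_vh|$, $|\partial_x\partial_th|$ are at most $B(v)$ for all $t\in[\tau,T]$, $x\in[0,1]$, $v\in\mathbb R$. Put $\sigma=\int_{\mathbb R}h\sqrt M\,dv$, $u=\int_{\mathbb R}v\,h\sqrt M\,dv$ and $E_h(t)=\frac12\|h(t)\|_V^2+\epsilon a\int_0^1u\,\partial_x\sigma\,dx$. Then $$\xi:=\min\Big\{\frac{\lambda-C_E-4a}{\epsilon^2},\ \frac{a(3C_s-2C_E)-4C_E}{8}\Big\}>0,$$ and for every $t>0$ the function $E_h$ is differentiable at $t$ and $$\begin{aligned}\partial_tE_h(t)+\xi\|h(t)\|_V^2\le{}&-\frac1\epsilon\int_{\mathbb R}\frac v2\big(h^2(t,1,v)-h^2(t,0,v)\big)dv-\frac1\epsilon\int_{\mathbb R}\frac v2\big((\partial_xh)^2(t,1,v)-(\partial_xh)^2(t,0,v)\big)dv\\&-a\big(u\,\partial_xu(t,1)-u\,\partial_xu(t,0)\big)+\frac{aC_s}{2\epsilon^2}\Big(\int_0^t\big(u(s,1)-u(s,0)\big)ds\Big)^2.\end{aligned}$$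 -/

import Mathlib

open MeasureTheory Set Filter Topology

namespace VFP

/-- The phase space `Ω = [0,1] × ℝ` of positions `x` and velocities `v`. -/
def phaseSpace : Set (ℝ × ℝ) := Icc (0 : ℝ) 1 ×ˢ (univ : Set ℝ)

/-- The global Maxwellian. -/
noncomputable def maxwellian (v : ℝ) : ℝ := 1 / √(2 * Real.pi) * Real.exp (-v ^ 2 / 2)

/-- Derivative in `x` on `[0,1]` (one-sided at the end points) of a function of position. -/
noncomputable def dx (s : ℝ → ℝ) (x : ℝ) : ℝ := derivWithin s (Icc 0 1) x

/-- `∂ₓ g` for a function `g(x,v)` on the phase space. -/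
noncomputable def partialX (g : ℝ → ℝ → ℝ) (x v : ℝ) : ℝ := dx (fun y => g y v) x

/-- `∂ᵥ g` for a function `g(x,v)` on the phase space. -/
noncomputable def partialV (g : ℝ → ℝ → ℝ) (x v : ℝ) : ℝ := deriv (g x) v

/-- `∂ₜ h` for a function `h(t,x,v)`. -/
noncomputable def partialT (h : ℝ → ℝ → ℝ → ℝ) (t x v : ℝ) : ℝ := deriv (fun s => h s x v) t

/-- The linearized Fokker-Planck operator acting in `v`,
`𝓛 g = M^{-1/2} ∂ᵥ (M ∂ᵥ (g / √M))`,
the operator of the form `⟨𝓛 g, k⟩ = -∫ M ∂ᵥ(g/√M) ∂ᵥ(k/√M)`. -/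
noncomputable def linFP (g : ℝ → ℝ) (v : ℝ) : ℝ :=
  deriv (fun w => maxwellian w * deriv (fun z => g z / √(maxwellian z)) w) v / √(maxwellian v)

/-- The squared norm `‖g‖_V² = ‖g‖² + ‖∂ₓ g‖²` over the phase space. -/
noncomputable def normVSq (g : ℝ → ℝ → ℝ) : ℝ :=
  (∫ p in phaseSpace, g p.1 p.2 ^ 2) + ∫ p in phaseSpace, partialX g p.1 p.2 ^ 2

/-- The density `σ(x) = ∫ g(x,v) √M dv`. -/
noncomputable def density (g : ℝ → ℝ → ℝ) (x : ℝ) : ℝ := ∫ v, g x v * √(maxwellian v)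

/-- The flux `u(x) = ∫ g(x,v) v √M dv`. -/
noncomputable def flux (g : ℝ → ℝ → ℝ) (x : ℝ) : ℝ := ∫ v, g x v * (v * √(maxwellian v))

/-- The Lyapunov functional `E_h(t) = ½ ‖h(t)‖_V² + ε a ⟨u(t), ∂ₓσ(t)⟩`. -/
noncomputable def lyapunov (ε a : ℝ) (h : ℝ → ℝ → ℝ → ℝ) (t : ℝ) : ℝ :=
  1 / 2 * normVSq (h t) + ε * a * ∫ x in (0 : ℝ)..1, flux (h t) x * dx (density (h t)) x

/-- The conditions on the electric field: regularity, the bounds by `C_E / 2 ≤ lam * C_s / 16`,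
and the conditions at the boundary. -/
structure ElectricFieldCond (E : ℝ → ℝ → ℝ) (C_E lam C_s : ℝ) : Prop where
  smooth : ∀ t, 0 ≤ t → ContDiffOn ℝ 3 (E t) (Icc 0 1)
  bound : ∀ t, 0 ≤ t → ∀ x ∈ Icc (0 : ℝ) 1, |E t x| ≤ C_E / 2
  bound_one : ∀ t, 0 ≤ t → ∀ x ∈ Icc (0 : ℝ) 1, |dx (E t) x| ≤ C_E / 2
  bound_three : ∀ t, 0 ≤ t → ∀ x ∈ Icc (0 : ℝ) 1,
    |iteratedDerivWithin 3 (E t) (Icc 0 1) x| ≤ C_E / 2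
  small : C_E / 2 ≤ lam * C_s / 16
  zero_left : ∀ t, 0 ≤ t → E t 0 = 0
  zero_right : ∀ t, 0 ≤ t → E t 1 = 0
  periodic_two : ∀ t, 0 ≤ t →
    iteratedDerivWithin 2 (E t) (Icc 0 1) 0 = iteratedDerivWithin 2 (E t) (Icc 0 1) 1

/-- `w` is the weak `x`-derivative of `g` in the interior of the phase space. -/
def IsWeakDx (g w : ℝ → ℝ → ℝ) : Prop :=
  ∀ φ : ℝ → ℝ → ℝ, ContDiff ℝ (⊤ : ℕ∞) (Function.uncurry φ) →
    HasCompactSupport (Function.uncurry φ) →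
    tsupport (Function.uncurry φ) ⊆ Ioo (0 : ℝ) 1 ×ˢ (univ : Set ℝ) →
    ∫ p in phaseSpace, g p.1 p.2 * deriv (fun y => φ y p.2) p.1
      = - ∫ p in phaseSpace, w p.1 p.2 * φ p.1 p.2

/-- `g` belongs to `V`, that is `g, ∂ₓ g ∈ L²(Ω)`, with weak derivative `∂ₓ g = w`. -/
structure MemV (g w : ℝ → ℝ → ℝ) : Prop where
  memLp : MemLp (Function.uncurry g) 2 (volume.restrict phaseSpace)
  memLp_dx : MemLp (Function.uncurry w) 2 (volume.restrict phaseSpace)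
  weakDx : IsWeakDx g w

/-- `h₀` lies in `V` and is the initial value of `h`: `h(t) → h₀` in `V` as `t ↓ 0`. -/
def HasInitialDatum (h : ℝ → ℝ → ℝ → ℝ) (h₀ : ℝ → ℝ → ℝ) : Prop :=
  ∃ w : ℝ → ℝ → ℝ, MemV h₀ w ∧
    Tendsto (fun t => (∫ p in phaseSpace, (h t p.1 p.2 - h₀ p.1 p.2) ^ 2)
        + ∫ p in phaseSpace, (partialX (h t) p.1 p.2 - w p.1 p.2) ^ 2)
      (𝓝[>] 0) (𝓝 0)

/-- Regularity of a strong solution for positive times: `h` is `C²` up to the boundary `x = 0, 1`,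
and, uniformly in `x` and locally uniformly in `t > 0`, the functions `(1+|v|)h`, `(1+|v|)∂ₓh`,
`∂ᵥh`, `∂ₜh` and the `x`-derivatives of the last two and of `∂ₓh` are dominated by a square
integrable function of `v`. -/
structure IsRegular (h : ℝ → ℝ → ℝ → ℝ) : Prop where
  contDiffOn : ContDiffOn ℝ 2 (fun p : ℝ × ℝ × ℝ => h p.1 p.2.1 p.2.2)
    (Ioi (0 : ℝ) ×ˢ Icc (0 : ℝ) 1 ×ˢ (univ : Set ℝ))
  dominated : ∀ τ T : ℝ, 0 < τ → ∃ B : ℝ → ℝ, MemLp B 2 volume ∧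
    ∀ t ∈ Icc τ T, ∀ x ∈ Icc (0 : ℝ) 1, ∀ v : ℝ,
      (1 + |v|) * |h t x v| ≤ B v ∧
      (1 + |v|) * |partialX (h t) x v| ≤ B v ∧
      |partialV (h t) x v| ≤ B v ∧
      |partialT h t x v| ≤ B v ∧
      |partialX (partialX (h t)) x v| ≤ B v ∧
      |partialX (partialV (h t)) x v| ≤ B v ∧
      |partialX (partialT h t) x v| ≤ B v

/-- `h` is a (strong) solution of the kinetic equation
`ε ∂ₜh + v ∂ₓh - ε⁻¹ 𝓛h = E (∂ᵥ - v/2) h`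
with the feedback boundary conditions given by `K = !![k₀₀, k₁₀; k₀₁, k₁₁]` and initial
datum `h₀`. -/
structure IsSolution (ε : ℝ) (E : ℝ → ℝ → ℝ) (K : Matrix (Fin 2) (Fin 2) ℝ)
    (h₀ : ℝ → ℝ → ℝ) (h : ℝ → ℝ → ℝ → ℝ) : Prop where
  regular : IsRegular h
  equation : ∀ t, 0 < t → ∀ x ∈ Ioo (0 : ℝ) 1, ∀ v : ℝ,
    ε * partialT h t x v + v * partialX (h t) x v - 1 / ε * linFP (h t x) v
      = E t x * (partialV (h t) x v - v / 2 * h t x v)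
  boundary_left : ∀ t, 0 < t → ∀ v, 0 < v →
    h t 0 v = K 0 0 * h t 0 (-v) + K 0 1 * h t 1 v
  boundary_right : ∀ t, 0 < t → ∀ v, v < 0 →
    h t 1 v = K 1 0 * h t 0 v + K 1 1 * h t 1 (-v)
  initial : HasInitialDatum h h₀

/-- The decay rate `ξ`. -/
noncomputable def rate (ε a C_E lam C_s : ℝ) : ℝ :=
  min ((lam - C_E - 4 * a) / ε ^ 2) ((a * (3 * C_s - 2 * C_E) - 4 * C_E) / 8)

end VFP

/-! This is a hypocoercivity argument. Write A = ∂ᵥ + v/2, which annihilates √M. Then 𝓛 = -A*A and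
∂ᵥ - v/2 = -A*, so the equation reads ε∂ₜh + v∂ₓh + ε⁻¹A*Ah + E A*h = 0. Testing it against h, and
its x-derivative against ∂ₓh, produces the dissipation ε⁻²(‖Ah‖² + ‖A∂ₓh‖²). By the Gaussian
Poincaré inequality `gaussian_poincare`, with constant 1, this controls the fluctuations h - σ√M and
∂ₓh - (∂ₓσ)√M, but not σ or ∂ₓσ.

The cross term εa⟨u, ∂ₓσ⟩ supplies the missing dissipation. Testing with v√M gives ε∂ₜu + ∂ₓσ + P +
u/ε + Eσ = 0, where P = ∫ ∂ₓh (v²-1)√M dv sees only the fluctuation of ∂ₓh. Testing the x-derivative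
of the equation with √M gives ε∂ₜ∂ₓσ + ∂ₓ²u = 0. Together they yield -a(∂ₓσ)², the total derivative
-a∂ₓ(u∂ₓu), and errors that the fluctuations absorb.

To recover σ itself, the Poincaré inequality on (0,1) bounds ∫σ² by ∫(∂ₓσ)² plus the squared mass.
Initially the mass vanishes, so at time t it is -ε⁻¹ times the accumulated net boundary flux
(`IsSolution.mass_eq`); this is the origin of the last term of the estimate.

The balance is made at each fixed x in `IsSolution.lyapunovDensityDt_add_le`, which reduces to the
inequality between real numbers `hypocoercive_inequality`. Integration in x then turns the transport
terms into boundary terms. Using the equation only in weak form in v avoids any decay assumption on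
∂ᵥ²h and any third derivative of h. -/

namespace VFP

/-! ### Differentiation and continuity of integrals depending on a parameter. -/

section ParametricIntegrals

/-- The mean value inequality on the convex set `I` bounds the difference quotients by `b`, so
dominated convergence applies. Derivatives within `I` are needed because x-derivatives are one-sided
at 0 and 1. -/
theorem hasDerivWithinAt_integral_of_dominated {α : Type*} [MeasurableSpace α] {μ : Measure α}
    {I : Set ℝ} (hI : Convex ℝ I) {s₀ : ℝ} (hs₀ : s₀ ∈ I) {F F' : ℝ → α → ℝ} {b : α → ℝ}
    (hF : ∀ s ∈ I, Integrable (F s) μ)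
    (hderiv : ∀ᵐ a ∂μ, ∀ s ∈ I, HasDerivWithinAt (fun r => F r a) (F' s a) I s)
    (hb : ∀ᵐ a ∂μ, ∀ s ∈ I, |F' s a| ≤ b a) (hbi : Integrable b μ) :
    HasDerivWithinAt (fun s => ∫ a, F s a ∂μ) (∫ a, F' s₀ a ∂μ) I s₀ := by
  rw [hasDerivWithinAt_iff_tendsto_slope]
  have hmem : ∀ᶠ s in 𝓝[I \ {s₀}] s₀, s ∈ I \ {s₀} := self_mem_nhdsWithin
  have h1 : Tendsto (fun s => ∫ a, (s - s₀)⁻¹ * (F s a - F s₀ a) ∂μ) (𝓝[I \ {s₀}] s₀)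
      (𝓝 (∫ a, F' s₀ a ∂μ)) := by
    refine tendsto_integral_filter_of_dominated_convergence b ?_ ?_ hbi ?_
    · filter_upwards [hmem] with s hs
      exact (((hF s hs.1).sub (hF s₀ hs₀)).const_mul _).aestronglyMeasurable
    · filter_upwards [hmem] with s hs
      filter_upwards [hderiv, hb] with a ha hba
      have h := hI.norm_image_sub_le_of_norm_hasDerivWithin_le (f := fun r => F r a)
        (f' := fun r => F' r a) (C := b a) ha hba hs₀ hs.1
      have hpos : 0 < |s - s₀| := abs_pos.2 (sub_ne_zero.2 hs.2)
      rw [norm_mul, norm_inv, Real.norm_eq_abs, inv_mul_le_iff₀ hpos, mul_comm]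
      exact h
    · filter_upwards [hderiv] with a ha
      have h := hasDerivWithinAt_iff_tendsto_slope.1 (ha s₀ hs₀)
      exact h
  refine h1.congr' ?_
  filter_upwards [hmem] with s hs
  rw [slope_def_module, integral_const_mul, integral_sub (hF s hs.1) (hF s₀ hs₀), smul_eq_mul]

theorem memLp_of_bound {α : Type*} [MeasurableSpace α] {μ : Measure α} {f B : α → ℝ}
    (hB : MemLp B 2 μ) (hf : AEStronglyMeasurable f μ) (h : ∀ a, |f a| ≤ B a) : MemLp f 2 μ :=
  hB.mono' hf (Eventually.of_forall h)

theorem _root_.MeasureTheory.MemLp.integrable_mul_two {α : Type*} [MeasurableSpace α]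
    {μ : Measure α} {f g : α → ℝ} (hf : MemLp f 2 μ) (hg : MemLp g 2 μ) :
    Integrable (fun a => f a * g a) μ :=
  hf.integrable_mul hg

/-- Differentiation of the pairing of two functions of `v` that depend on a parameter. -/
theorem hasDerivWithinAt_integral_mul {I : Set ℝ} (hI : Convex ℝ I) {s₀ : ℝ} (hs₀ : s₀ ∈ I)
    {F F' G G' : ℝ → ℝ → ℝ} {B C : ℝ → ℝ} (hB : MemLp B 2 volume) (hC : MemLp C 2 volume)
    (hFm : ∀ s ∈ I, AEStronglyMeasurable (F s) volume)
    (hGm : ∀ s ∈ I, AEStronglyMeasurable (G s) volume)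
    (hF : ∀ s ∈ I, ∀ v, HasDerivWithinAt (fun r => F r v) (F' s v) I s)
    (hG : ∀ s ∈ I, ∀ v, HasDerivWithinAt (fun r => G r v) (G' s v) I s)
    (hFB : ∀ s ∈ I, ∀ v, |F s v| ≤ B v) (hFB' : ∀ s ∈ I, ∀ v, |F' s v| ≤ B v)
    (hGC : ∀ s ∈ I, ∀ v, |G s v| ≤ C v) (hGC' : ∀ s ∈ I, ∀ v, |G' s v| ≤ C v) :
    HasDerivWithinAt (fun s => ∫ v, F s v * G s v) (∫ v, (F' s₀ v * G s₀ v + F s₀ v * G' s₀ v))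
      I s₀ := by
  refine hasDerivWithinAt_integral_of_dominated hI hs₀ (b := fun v => 2 * (B v * C v))
    (F' := fun s v => F' s v * G s v + F s v * G' s v) ?_ ?_ ?_ ?_
  · intro s hs
    exact (memLp_of_bound hB (hFm s hs) (hFB s hs)).integrable_mul_two
      (memLp_of_bound hC (hGm s hs) (hGC s hs))
  · exact Eventually.of_forall fun v s hs => (hF s hs v).mul (hG s hs v)
  · refine Eventually.of_forall fun v s hs => ?_
    have h0 : 0 ≤ B v := (abs_nonneg _).trans (hFB s hs v)
    calc |F' s v * G s v + F s v * G' s v| ≤ |F' s v * G s v| + |F s v * G' s v| := abs_add_le _ _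
      _ ≤ B v * C v + B v * C v := by
        rw [abs_mul, abs_mul]
        exact add_le_add
          (mul_le_mul (hFB' s hs v) (hGC s hs v) (abs_nonneg _) h0)
          (mul_le_mul (hFB s hs v) (hGC' s hs v) (abs_nonneg _) h0)
      _ = 2 * (B v * C v) := by ring
  · exact (hB.integrable_mul_two hC).const_mul 2

/-- Differentiation of the pairing with a fixed function of `v`. -/
theorem hasDerivWithinAt_integral_mul_const {I : Set ℝ} (hI : Convex ℝ I) {s₀ : ℝ} (hs₀ : s₀ ∈ I)
    {F F' : ℝ → ℝ → ℝ} {B ψ : ℝ → ℝ} (hB : MemLp B 2 volume) (hψ : MemLp ψ 2 volume)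
    (hF2 : ∀ s ∈ I, MemLp (F s) 2 volume)
    (hF : ∀ s ∈ I, ∀ v, HasDerivWithinAt (fun r => F r v) (F' s v) I s)
    (hFB' : ∀ s ∈ I, ∀ v, |F' s v| ≤ B v) :
    HasDerivWithinAt (fun s => ∫ v, F s v * ψ v) (∫ v, F' s₀ v * ψ v) I s₀ := by
  refine hasDerivWithinAt_integral_of_dominated hI hs₀ (b := fun v => B v * |ψ v|)
    (F' := fun s v => F' s v * ψ v) ?_ ?_ ?_ ?_
  · exact fun s hs => (hF2 s hs).integrable_mul_two hψ
  · exact Eventually.of_forall fun v s hs => (hF s hs v).mul_const _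
  · refine Eventually.of_forall fun v s hs => ?_
    rw [abs_mul]
    exact mul_le_mul_of_nonneg_right (hFB' s hs v) (abs_nonneg _)
  · exact hB.integrable_mul_two hψ.abs

theorem continuousOn_integral_mul {I : Set ℝ} {F G : ℝ → ℝ → ℝ} {B C : ℝ → ℝ}
    (hB : MemLp B 2 volume) (hC : MemLp C 2 volume)
    (hFm : ∀ s ∈ I, AEStronglyMeasurable (F s) volume)
    (hGm : ∀ s ∈ I, AEStronglyMeasurable (G s) volume)
    (hF : ∀ v, ContinuousOn (fun r => F r v) I) (hG : ∀ v, ContinuousOn (fun r => G r v) I)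
    (hFB : ∀ s ∈ I, ∀ v, |F s v| ≤ B v) (hGC : ∀ s ∈ I, ∀ v, |G s v| ≤ C v) :
    ContinuousOn (fun s => ∫ v, F s v * G s v) I := by
  refine continuousOn_of_dominated (bound := fun v => B v * C v) ?_ ?_ (hB.integrable_mul_two hC) ?_
  · exact fun s hs => (hFm s hs).mul (hGm s hs)
  · refine fun s hs => Eventually.of_forall fun v => ?_
    rw [norm_mul]
    exact mul_le_mul (hFB s hs v) (hGC s hs v) (abs_nonneg _) ((abs_nonneg _).trans (hFB s hs v))
  · exact Eventually.of_forall fun v => (hF v).mul (hG v)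

end ParametricIntegrals

/-! ### Young and Cauchy-Schwarz inequalities for square integrable functions. -/

section SquareIntegrals

variable {α : Type*} [MeasurableSpace α] {μ : Measure α}

theorem abs_integral_mul_le {f g : α → ℝ} (hf : MemLp f 2 μ) (hg : MemLp g 2 μ) :
    |∫ a, f a * g a ∂μ| ≤ 1 / 2 * ((∫ a, f a ^ 2 ∂μ) + ∫ a, g a ^ 2 ∂μ) := by
  rw [← integral_add hf.integrable_sq hg.integrable_sq, ← integral_const_mul]
  refine (abs_integral_le_integral_abs).trans
    (integral_mono (hf.integrable_mul_two hg).abs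
      ((hf.integrable_sq.add hg.integrable_sq).const_mul _) fun a => ?_)
  simp only
  rw [abs_mul]
  nlinarith [sq_nonneg (|f a| - |g a|), sq_abs (f a), sq_abs (g a)]

/-- The Cauchy-Schwarz inequality for square integrable functions. -/
theorem sq_integral_mul_le {f g : α → ℝ} (hf : MemLp f 2 μ) (hg : MemLp g 2 μ) :
    (∫ a, f a * g a ∂μ) ^ 2 ≤ (∫ a, f a ^ 2 ∂μ) * ∫ a, g a ^ 2 ∂μ := by
  have key : ∀ s : ℝ, 0 ≤ (∫ a, g a ^ 2 ∂μ) * (s * s) + (2 * ∫ a, f a * g a ∂μ) * s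
      + ∫ a, f a ^ 2 ∂μ := by
    intro s
    have h : ∫ a, (f a + s * g a) ^ 2 ∂μ = (∫ a, g a ^ 2 ∂μ) * (s * s)
        + (2 * ∫ a, f a * g a ∂μ) * s + ∫ a, f a ^ 2 ∂μ := by
      have h1 : ∀ a, (f a + s * g a) ^ 2
          = (s * s) * g a ^ 2 + (2 * s) * (f a * g a) + f a ^ 2 := fun a => by ring
      simp_rw [h1]
      have i1 : Integrable (fun a => (s * s) * g a ^ 2) μ := hg.integrable_sq.const_mul _
      have i2 : Integrable (fun a => (2 * s) * (f a * g a)) μ :=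
        (hf.integrable_mul_two hg).const_mul _
      have i12 : Integrable (fun a => (s * s) * g a ^ 2 + (2 * s) * (f a * g a)) μ := i1.add i2
      rw [integral_add i12 hf.integrable_sq, integral_add i1 i2, integral_const_mul,
        integral_const_mul]
      ring
    rw [← h]
    exact integral_nonneg fun a => sq_nonneg _
  have := discrim_le_zero key
  rw [discrim] at this
  linarith

end SquareIntegrals

/-- The Poincaré inequality on the unit interval. -/
theorem poincare_unitInterval {s s' : ℝ → ℝ}
    (hs : ∀ x ∈ Icc (0 : ℝ) 1, HasDerivWithinAt s (s' x) (Icc 0 1) x)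
    (hs' : ContinuousOn s' (Icc 0 1)) :
    (∫ x in (0 : ℝ)..1, s x ^ 2) - (∫ x in (0 : ℝ)..1, s x) ^ 2 ≤ ∫ x in (0 : ℝ)..1, s' x ^ 2 := by
  have hc : ContinuousOn s (Icc 0 1) := fun x hx => (hs x hx).continuousWithinAt
  -- Deviations are measured from `s 0` instead of the mean. This suffices, since the mean square
  -- deviation is smallest about the mean.
  have hpt : ∀ x ∈ Icc (0 : ℝ) 1, (s x - s 0) ^ 2 ≤ ∫ y in (0 : ℝ)..1, s' y ^ 2 := by
    intro x hx
    have hsub : Icc (0 : ℝ) x ⊆ Icc 0 1 := Icc_subset_Icc_right hx.2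
    have hi : IntervalIntegrable s' volume 0 x :=
      (hs'.mono hsub).intervalIntegrable_of_Icc hx.1
    have hi2 : IntervalIntegrable (fun y => s' y ^ 2) volume 0 x :=
      ((hs'.pow 2).mono hsub).intervalIntegrable_of_Icc hx.1
    have hi3 : IntervalIntegrable (fun y => s' y ^ 2) volume x 1 :=
      ((hs'.pow 2).mono (Icc_subset_Icc_left hx.1)).intervalIntegrable_of_Icc hx.2
    have hftc : ∫ y in (0 : ℝ)..x, s' y = s x - s 0 := by
      refine intervalIntegral.integral_eq_sub_of_hasDerivAt_of_le hx.1 (hc.mono hsub) ?_ hi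
      intro y hy
      exact (hs y ⟨hy.1.le, hy.2.le.trans hx.2⟩).hasDerivAt
        (Icc_mem_nhds hy.1 (hy.2.trans_le hx.2))
    set d := s x - s 0
    -- Expanding this square gives (2 - x)d² ≤ ∫₀ˣ s'², and 2 - x ≥ 1. No division by x is needed.
    have h1 : 0 ≤ ∫ y in (0 : ℝ)..x, (s' y - d) ^ 2 :=
      intervalIntegral.integral_nonneg hx.1 fun y _ => sq_nonneg _
    have h2 : ∫ y in (0 : ℝ)..x, (s' y - d) ^ 2
        = (∫ y in (0 : ℝ)..x, s' y ^ 2) - 2 * d * d + x * d ^ 2 := by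
      have : ∀ y, (s' y - d) ^ 2 = s' y ^ 2 - 2 * d * s' y + d ^ 2 := fun y => by ring
      simp_rw [this]
      rw [intervalIntegral.integral_add (hi2.sub (hi.const_mul _)) intervalIntegrable_const,
        intervalIntegral.integral_sub hi2 (hi.const_mul _), intervalIntegral.integral_const_mul,
        intervalIntegral.integral_const, hftc]
      simp
    have h3 : (∫ y in (0 : ℝ)..x, s' y ^ 2) + (∫ y in x..1, s' y ^ 2)
        = ∫ y in (0 : ℝ)..1, s' y ^ 2 :=
      intervalIntegral.integral_add_adjacent_intervals hi2 hi3
    have h4 : 0 ≤ ∫ y in x..1, s' y ^ 2 :=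
      intervalIntegral.integral_nonneg hx.2 fun y _ => sq_nonneg _
    nlinarith [mul_nonneg (sub_nonneg.2 hx.2) (sq_nonneg d)]
  have hsi : IntervalIntegrable s volume 0 1 := hc.intervalIntegrable_of_Icc zero_le_one
  have hsi2 : IntervalIntegrable (fun x => s x ^ 2) volume 0 1 :=
    (hc.pow 2).intervalIntegrable_of_Icc zero_le_one
  have hmono : ∫ x in (0 : ℝ)..1, (s x - s 0) ^ 2 ≤ ∫ _x in (0 : ℝ)..1, ∫ y in (0 : ℝ)..1, s' y ^ 2 := by
    refine intervalIntegral.integral_mono_on zero_le_one ?_ intervalIntegrable_const hpt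
    exact ((hc.sub continuousOn_const).pow 2).intervalIntegrable_of_Icc zero_le_one
  have hexp : ∫ x in (0 : ℝ)..1, (s x - s 0) ^ 2
      = (∫ x in (0 : ℝ)..1, s x ^ 2) - 2 * s 0 * (∫ x in (0 : ℝ)..1, s x) + s 0 ^ 2 := by
    have : ∀ y, (s y - s 0) ^ 2 = s y ^ 2 - 2 * s 0 * s y + s 0 ^ 2 := fun y => by ring
    simp_rw [this]
    rw [intervalIntegral.integral_add (hsi2.sub (hsi.const_mul _)) intervalIntegrable_const,
      intervalIntegral.integral_sub hsi2 (hsi.const_mul _), intervalIntegral.integral_const_mul,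
      intervalIntegral.integral_const]
    simp
  rw [intervalIntegral.integral_const] at hmono
  simp only [sub_zero, one_smul] at hmono
  nlinarith [sq_nonneg ((∫ x in (0 : ℝ)..1, s x) - s 0)]

/-! ### The ground state √M, its moments, and the Gaussian Poincaré inequality. -/

section Gaussian

/-- The square root of the Maxwellian, the ground state of the Fokker-Planck operator. -/
noncomputable def sqrtM (v : ℝ) : ℝ := √(maxwellian v)

theorem maxwellian_pos (v : ℝ) : 0 < maxwellian v := by
  unfold maxwellian
  positivity

theorem sqrtM_pos (v : ℝ) : 0 < sqrtM v := Real.sqrt_pos.2 (maxwellian_pos v)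

theorem sqrtM_sq (v : ℝ) : sqrtM v ^ 2 = maxwellian v := Real.sq_sqrt (maxwellian_pos v).le

theorem sqrtM_eq (v : ℝ) : sqrtM v = √(1 / √(2 * Real.pi)) * Real.exp (-v ^ 2 / 4) := by
  unfold sqrtM maxwellian
  rw [Real.sqrt_mul (by positivity), Real.sqrt_eq_rpow (Real.exp _), ← Real.exp_mul]
  ring_nf

theorem hasDerivAt_sqrtM (v : ℝ) : HasDerivAt sqrtM (-(v / 2) * sqrtM v) v := by
  have h : HasDerivAt (fun v : ℝ => √(1 / √(2 * Real.pi)) * Real.exp (-v ^ 2 / 4))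
      (√(1 / √(2 * Real.pi)) * (Real.exp (-v ^ 2 / 4) * (-(2 * v) / 4))) v := by
    have := ((hasDerivAt_pow 2 v).neg.div_const 4).exp.const_mul √(1 / √(2 * Real.pi))
    simpa using this
  rw [funext sqrtM_eq]
  convert h using 1
  ring

theorem continuous_sqrtM : Continuous sqrtM :=
  continuous_iff_continuousAt.2 fun v => (hasDerivAt_sqrtM v).continuousAt

theorem integrable_pow_mul_maxwellian (n : ℕ) : Integrable fun v : ℝ => v ^ n * maxwellian v := by
  have h := (integrable_rpow_mul_exp_neg_mul_sq (b := 1 / 2) (by norm_num) (s := n)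
    (by linarith [(Nat.cast_nonneg n : (0 : ℝ) ≤ n)])).const_mul (1 / √(2 * Real.pi))
  refine h.congr (Eventually.of_forall fun v => ?_)
  simp only [maxwellian, Real.rpow_natCast]
  rw [show -(1 / 2) * v ^ 2 = -v ^ 2 / 2 by ring]
  ring

theorem memLp_pow_mul_sqrtM (n : ℕ) : MemLp (fun v => v ^ n * sqrtM v) 2 volume := by
  have hm : Continuous fun v => v ^ n * sqrtM v := (continuous_pow n).mul continuous_sqrtM
  rw [memLp_two_iff_integrable_sq hm.aestronglyMeasurable]
  refine (integrable_pow_mul_maxwellian (2 * n)).congr (Eventually.of_forall fun v => ?_)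
  simp only
  rw [mul_pow, sqrtM_sq, ← pow_mul, mul_comm n 2]

theorem memLp_sqrtM : MemLp sqrtM 2 volume := by
  simpa using memLp_pow_mul_sqrtM 0

theorem memLp_mul_sqrtM : MemLp (fun v => v * sqrtM v) 2 volume := by
  simpa using memLp_pow_mul_sqrtM 1

theorem integral_maxwellian : ∫ v, maxwellian v = 1 := by
  have h := ProbabilityTheory.integral_gaussianPDFReal_eq_one 0 (v := 1) one_ne_zero
  rw [← h]
  congr 1
  ext v
  simp [maxwellian, ProbabilityTheory.gaussianPDFReal]

theorem hasDerivAt_maxwellian (v : ℝ) : HasDerivAt maxwellian (-v * maxwellian v) v := by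
  have h := (hasDerivAt_sqrtM v).pow 2
  rw [show (sqrtM ^ 2) = maxwellian from funext sqrtM_sq] at h
  refine h.congr_deriv ?_
  rw [← sqrtM_sq]
  simp
  ring

/-- Integrate the derivative of vⁿ⁺¹M over the line, using M' = -vM. -/
theorem integral_pow_add_two_mul_maxwellian (n : ℕ) :
    ∫ v, v ^ (n + 2) * maxwellian v = (n + 1) * ∫ v, v ^ n * maxwellian v := by
  have hd : ∀ v : ℝ, HasDerivAt (fun v => v ^ (n + 1) * maxwellian v)
      ((n + 1) * (v ^ n * maxwellian v) - v ^ (n + 2) * maxwellian v) v := by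
    intro v
    refine ((hasDerivAt_pow (n + 1) v).mul (hasDerivAt_maxwellian v)).congr_deriv ?_
    simp
    ring
  have i1 : Integrable fun v : ℝ => ((n : ℝ) + 1) * (v ^ n * maxwellian v) :=
    (integrable_pow_mul_maxwellian n).const_mul _
  have h := integral_eq_zero_of_hasDerivAt_of_integrable hd
    (i1.sub (integrable_pow_mul_maxwellian (n + 2))) (integrable_pow_mul_maxwellian (n + 1))
  rw [integral_sub i1 (integrable_pow_mul_maxwellian (n + 2)), integral_const_mul] at h
  linarith

theorem integral_sqrtM_sq : ∫ v, sqrtM v ^ 2 = 1 := by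
  simp_rw [sqrtM_sq]
  exact integral_maxwellian

theorem integral_mul_sqrtM_sq : ∫ v, (v * sqrtM v) ^ 2 = 1 := by
  simp_rw [mul_pow, sqrtM_sq]
  simpa [integral_maxwellian] using integral_pow_add_two_mul_maxwellian 0

theorem integral_sq_sub_one_mul_sqrtM_sq : ∫ v, ((v ^ 2 - 1) * sqrtM v) ^ 2 = 2 := by
  have h2 : ∫ v, v ^ 2 * maxwellian v = 1 := by
    simpa [integral_maxwellian] using integral_pow_add_two_mul_maxwellian 0
  have h4 : ∫ v, v ^ 4 * maxwellian v = 3 := by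
    have := integral_pow_add_two_mul_maxwellian 2
    norm_num [h2] at this
    exact this
  have hp : ∀ v, ((v ^ 2 - 1) * sqrtM v) ^ 2
      = v ^ 4 * maxwellian v - 2 * (v ^ 2 * maxwellian v) + maxwellian v := by
    intro v
    rw [mul_pow, sqrtM_sq]
    ring
  simp_rw [hp]
  have i0 : Integrable maxwellian := by simpa using integrable_pow_mul_maxwellian 0
  have i2 : Integrable fun v : ℝ => 2 * (v ^ 2 * maxwellian v) :=
    (integrable_pow_mul_maxwellian 2).const_mul 2
  have i42 : Integrable fun v : ℝ => v ^ 4 * maxwellian v - 2 * (v ^ 2 * maxwellian v) :=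
    (integrable_pow_mul_maxwellian 4).sub i2
  rw [integral_add i42 i0, integral_sub (integrable_pow_mul_maxwellian 4) i2, integral_const_mul,
    h2, h4, integral_maxwellian]
  norm_num

theorem memLp_sq_sub_one_mul_sqrtM : MemLp (fun v => (v ^ 2 - 1) * sqrtM v) 2 volume := by
  refine ((memLp_pow_mul_sqrtM 2).sub memLp_sqrtM).ae_eq (Eventually.of_forall fun v => ?_)
  simp
  ring

theorem integral_sqrtM_mul_mul_sqrtM : ∫ v, v * sqrtM v * sqrtM v = 0 := by
  have h := integral_eq_zero_of_hasDerivAt_of_integrable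
    (fun v => (hasDerivAt_maxwellian v)) ?_ ?_
  · rw [← neg_eq_zero, ← integral_neg, ← h]
    congr 1
    ext v
    rw [← sqrtM_sq]
    ring
  · refine (integrable_pow_mul_maxwellian 1).neg.congr (Eventually.of_forall fun v => ?_)
    simp
  · simpa using integrable_pow_mul_maxwellian 0

theorem integral_sq_sub_one_mul_maxwellian : ∫ v, (v ^ 2 - 1) * sqrtM v * sqrtM v = 0 := by
  have h2 : ∫ v, v ^ 2 * maxwellian v = 1 := by
    simpa [integral_maxwellian] using integral_pow_add_two_mul_maxwellian 0
  have i0 : Integrable maxwellian := by simpa using integrable_pow_mul_maxwellian 0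
  have hp : ∀ v, (v ^ 2 - 1) * sqrtM v * sqrtM v = v ^ 2 * maxwellian v - maxwellian v := by
    intro v
    rw [← sqrtM_sq]
    ring
  simp_rw [hp]
  rw [integral_sub (integrable_pow_mul_maxwellian 2) i0, h2, integral_maxwellian, sub_self]

/-- The Hardy type inequality behind the Gaussian Poincaré inequality, on a bounded interval. -/
theorem integral_sq_le_of_zero_left {g g' : ℝ → ℝ} (hg : ∀ v, HasDerivAt g (g' v) v)
    (hg' : Continuous g') (h0 : g 0 = 0) {R : ℝ} (hR : 0 ≤ R) :
    ∫ v in (0 : ℝ)..R, g v ^ 2 ≤ ∫ v in (0 : ℝ)..R, (g' v + v / 2 * g v) ^ 2 := by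
  have hgc : Continuous g := continuous_iff_continuousAt.2 fun v => (hg v).continuousAt
  have hk : Continuous fun v => (g' v + v / 2 * g v) ^ 2 := by fun_prop
  -- The comparison function is g²/v: subtracting its derivative and g² from (g' + vg/2)² leaves the
  -- perfect square (g' + vg/2 - g/v)². It vanishes at 0 because g does, and is nonnegative at R.
  have hd : ∀ v ∈ Ioo (0 : ℝ) R,
      HasDerivAt (fun v => g v ^ 2 / v) (2 * g v * g' v / v - g v ^ 2 / v ^ 2) v := by
    intro v hv
    have hv0 : v ≠ 0 := hv.1.ne'
    refine (((hg v).pow 2).div (hasDerivAt_id v) hv0).congr_deriv ?_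
    simp
    field_simp
  have hcont : ContinuousOn (fun v => g v ^ 2 / v) (Icc 0 R) := by
    intro v hv
    rcases eq_or_ne v 0 with rfl | hv0
    · refine ContinuousAt.continuousWithinAt ?_
      have hs := (hasDerivAt_iff_tendsto_slope.1 (hg 0))
      have hmul : Tendsto (fun v => g v * slope g 0 v) (𝓝[≠] 0) (𝓝 (g 0 * g' 0)) :=
        ((hgc.tendsto 0).mono_left nhdsWithin_le_nhds).mul hs
      rw [continuousAt_iff_punctured_nhds]
      simp only [h0, zero_mul] at hmul
      simp only [h0, div_zero]
      refine hmul.congr fun v => ?_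
      simp only [slope_def_field, h0, sub_zero]
      ring
    · exact ((hgc.continuousAt.pow 2).div continuousAt_id hv0).continuousWithinAt
  have key := intervalIntegral.sub_le_integral_of_hasDeriv_right_of_le hR hcont
    (fun v hv => (hd v hv).hasDerivWithinAt)
    (φ := fun v => (g' v + v / 2 * g v) ^ 2 - g v ^ 2)
    ((hk.sub (hgc.pow 2)).integrableOn_Icc) (fun v hv => by
      have hv0 : v ≠ 0 := hv.1.ne'
      have : (g' v + v / 2 * g v) ^ 2 - g v ^ 2 - (2 * g v * g' v / v - g v ^ 2 / v ^ 2)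
          = (g' v + v / 2 * g v - g v / v) ^ 2 := by
        field_simp
        ring
      nlinarith [sq_nonneg (g' v + v / 2 * g v - g v / v)])
  have hg2 : Continuous fun v => g v ^ 2 := hgc.pow 2
  rw [intervalIntegral.integral_sub (hk.intervalIntegrable _ _)
    (hg2.intervalIntegrable _ _)] at key
  have : 0 ≤ g R ^ 2 / R := by positivity
  simp only [h0, div_zero] at key
  linarith

theorem setIntegral_Ioi_sq_le_of_zero_left {g g' : ℝ → ℝ} (hg : ∀ v, HasDerivAt g (g' v) v)
    (hg' : Continuous g') (h0 : g 0 = 0) (hgi : Integrable fun v => g v ^ 2)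
    (hki : Integrable fun v => (g' v + v / 2 * g v) ^ 2) :
    ∫ v in Ioi (0 : ℝ), g v ^ 2 ≤ ∫ v in Ioi (0 : ℝ), (g' v + v / 2 * g v) ^ 2 := by
  refine le_of_tendsto_of_tendsto
    (intervalIntegral_tendsto_integral_Ioi 0 hgi.integrableOn tendsto_id)
    (intervalIntegral_tendsto_integral_Ioi 0 hki.integrableOn tendsto_id) ?_
  filter_upwards [eventually_ge_atTop 0] with R hR
  exact integral_sq_le_of_zero_left hg hg' h0 hR

theorem integral_sq_le_of_zero {g g' : ℝ → ℝ} (hg : ∀ v, HasDerivAt g (g' v) v)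
    (hg' : Continuous g') (h0 : g 0 = 0) (hgi : Integrable fun v => g v ^ 2)
    (hki : Integrable fun v => (g' v + v / 2 * g v) ^ 2) :
    ∫ v, g v ^ 2 ≤ ∫ v, (g' v + v / 2 * g v) ^ 2 := by
  have hr := setIntegral_Ioi_sq_le_of_zero_left hg hg' h0 hgi hki
  have hl := setIntegral_Ioi_sq_le_of_zero_left (g := fun v => g (-v)) (g' := fun v => -g' (-v))
    (fun v => ((hg (-v)).comp v (hasDerivAt_neg v)).congr_deriv (by ring)) (by fun_prop) (by simpa using h0)
    hgi.comp_neg ((hki.comp_neg).congr (Eventually.of_forall fun v => by simp only; ring))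
  have hl' : ∫ v in Iic (0 : ℝ), g v ^ 2 ≤ ∫ v in Iic (0 : ℝ), (g' v + v / 2 * g v) ^ 2 := by
    rw [← neg_zero, ← integral_comp_neg_Ioi, ← integral_comp_neg_Ioi]
    refine hl.trans_eq ?_
    congr 1
    ext v
    ring
  rw [← intervalIntegral.integral_Iic_add_Ioi hgi.integrableOn hgi.integrableOn (b := 0),
    ← intervalIntegral.integral_Iic_add_Ioi hki.integrableOn hki.integrableOn (b := 0)]
  exact add_le_add hl' hr

/-- The Gaussian Poincaré inequality in the flat space `L²(dv)`. -/
theorem gaussian_poincare {f f' : ℝ → ℝ} (hf : ∀ v, HasDerivAt f (f' v) v)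
    (hf' : Continuous f') (hf2 : MemLp f 2 volume)
    (hk2 : MemLp (fun v => f' v + v / 2 * f v) 2 volume) :
    ∫ v, f v ^ 2 ≤ (∫ v, f v * sqrtM v) ^ 2 + ∫ v, (f' v + v / 2 * f v) ^ 2 := by
  -- Subtracting β√M makes the function vanish at 0 without changing f' + vf/2. The excess (β -
  -- ∫f√M)² created by using β instead of the projection coefficient is dropped at the end.
  set β := f 0 / sqrtM 0 with hβ
  have hg : ∀ v, HasDerivAt (fun v => f v - β * sqrtM v) (f' v - β * (-(v / 2) * sqrtM v)) v :=
    fun v => (hf v).sub ((hasDerivAt_sqrtM v).const_mul β)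
  have hsame : ∀ v, (f' v - β * (-(v / 2) * sqrtM v)) + v / 2 * (f v - β * sqrtM v)
      = f' v + v / 2 * f v := fun v => by ring
  have hg2 : MemLp (fun v => f v - β * sqrtM v) 2 volume := hf2.sub (memLp_sqrtM.const_mul β)
  have hc := continuous_sqrtM
  have h := integral_sq_le_of_zero hg (by fun_prop)
    (by rw [hβ, div_mul_cancel₀ _ (sqrtM_pos 0).ne', sub_self]) hg2.integrable_sq
    (by simp_rw [hsame]; exact hk2.integrable_sq)
  simp_rw [hsame] at h
  have hexp : ∫ v, (f v - β * sqrtM v) ^ 2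
      = (∫ v, f v ^ 2) - 2 * β * (∫ v, f v * sqrtM v) + β ^ 2 := by
    have e : ∀ v, (f v - β * sqrtM v) ^ 2
        = f v ^ 2 - 2 * β * (f v * sqrtM v) + β ^ 2 * sqrtM v ^ 2 := fun v => by ring
    simp_rw [e]
    have i1 := hf2.integrable_sq
    have i2 : Integrable fun v => 2 * β * (f v * sqrtM v) :=
      (hf2.integrable_mul_two memLp_sqrtM).const_mul _
    have i3 : Integrable fun v => β ^ 2 * sqrtM v ^ 2 := memLp_sqrtM.integrable_sq.const_mul _
    have i12 : Integrable fun v => f v ^ 2 - 2 * β * (f v * sqrtM v) := i1.sub i2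
    rw [integral_add i12 i3, integral_sub i1 i2, integral_const_mul, integral_const_mul,
      integral_sqrtM_sq, mul_one]
  nlinarith [sq_nonneg (β - ∫ v, f v * sqrtM v)]

end Gaussian

/-! ### Partial derivatives of a strong solution up to the boundary. -/

section Regularity

/-- The time-phase domain `(0,∞) × [0,1] × ℝ`. -/
def timePhase : Set (ℝ × ℝ × ℝ) := Ioi (0 : ℝ) ×ˢ Icc (0 : ℝ) 1 ×ˢ (univ : Set ℝ)

theorem mem_timePhase {t x v : ℝ} (ht : 0 < t) (hx : x ∈ Icc (0 : ℝ) 1) :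
    (t, x, v) ∈ timePhase := ⟨ht, hx, mem_univ _⟩

theorem uniqueDiffOn_timePhase : UniqueDiffOn ℝ timePhase :=
  (uniqueDiffOn_Ioi 0).prod ((uniqueDiffOn_Icc zero_lt_one).prod uniqueDiffOn_univ)

/-- This is what makes the second derivative symmetric also at the boundary points x = 0, 1. -/
theorem timePhase_subset_closure_interior : timePhase ⊆ closure (interior timePhase) := by
  have h : interior timePhase = Ioi (0 : ℝ) ×ˢ Ioo (0 : ℝ) 1 ×ˢ (univ : Set ℝ) := by
    simp [timePhase, interior_prod_eq]
  rw [h, closure_prod_eq, closure_prod_eq, closure_Ioo zero_ne_one, closure_Ioi, closure_univ]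
  exact prod_mono Ioi_subset_Ici_self Subset.rfl

variable {G : ℝ × ℝ × ℝ → ℝ} {G' : ℝ × ℝ × ℝ →L[ℝ] ℝ} {t x v : ℝ}

theorem HasFDerivWithinAt.hasDerivAt_time (hG : HasFDerivWithinAt G G' timePhase (t, x, v))
    (ht : 0 < t) (hx : x ∈ Icc (0 : ℝ) 1) :
    HasDerivAt (fun s => G (s, x, v)) (G' (1, 0, 0)) t := by
  have hc : HasDerivWithinAt (fun s : ℝ => (s, x, v)) ((1, 0, 0) : ℝ × ℝ × ℝ) (Ioi 0) t :=
    ((hasDerivAt_id t).prodMk (hasDerivAt_const t (x, v))).hasDerivWithinAt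
  exact (hG.comp_hasDerivWithinAt t hc fun s hs => mem_timePhase hs hx).hasDerivAt (Ioi_mem_nhds ht)

theorem HasFDerivWithinAt.hasDerivWithinAt_space
    (hG : HasFDerivWithinAt G G' timePhase (t, x, v)) (ht : 0 < t) :
    HasDerivWithinAt (fun y => G (t, y, v)) (G' (0, 1, 0)) (Icc 0 1) x := by
  have hc : HasDerivWithinAt (fun y : ℝ => (t, y, v)) ((0, 1, 0) : ℝ × ℝ × ℝ) (Icc 0 1) x :=
    ((hasDerivAt_const x t).prodMk ((hasDerivAt_id x).prodMk
      (hasDerivAt_const x v))).hasDerivWithinAt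
  exact hG.comp_hasDerivWithinAt x hc fun y hy => mem_timePhase ht hy

theorem HasFDerivWithinAt.hasDerivAt_velocity (hG : HasFDerivWithinAt G G' timePhase (t, x, v))
    (ht : 0 < t) (hx : x ∈ Icc (0 : ℝ) 1) :
    HasDerivAt (fun w => G (t, x, w)) (G' (0, 0, 1)) v := by
  have hc : HasDerivWithinAt (fun w : ℝ => (t, x, w)) ((0, 0, 1) : ℝ × ℝ × ℝ) univ v :=
    ((hasDerivAt_const v t).prodMk ((hasDerivAt_const v x).prodMk
      (hasDerivAt_id v))).hasDerivWithinAt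
  exact (hG.comp_hasDerivWithinAt v hc fun w _ => mem_timePhase ht hx).hasDerivAt univ_mem

variable {h : ℝ → ℝ → ℝ → ℝ}

/-- The total derivative of `h` on the time-phase domain. -/
noncomputable def totalD (h : ℝ → ℝ → ℝ → ℝ) (p : ℝ × ℝ × ℝ) : ℝ × ℝ × ℝ →L[ℝ] ℝ :=
  fderivWithin ℝ (fun p : ℝ × ℝ × ℝ => h p.1 p.2.1 p.2.2) timePhase p

/-- The second total derivative of `h` on the time-phase domain. -/
noncomputable def totalD2 (h : ℝ → ℝ → ℝ → ℝ) (p : ℝ × ℝ × ℝ) :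
    ℝ × ℝ × ℝ →L[ℝ] ℝ × ℝ × ℝ →L[ℝ] ℝ :=
  fderivWithin ℝ (totalD h) timePhase p

namespace IsRegular

theorem contDiffOn_totalD (hh : IsRegular h) : ContDiffOn ℝ 1 (totalD h) timePhase :=
  hh.contDiffOn.fderivWithin uniqueDiffOn_timePhase (by norm_num)

theorem continuousOn_totalD2 (hh : IsRegular h) : ContinuousOn (totalD2 h) timePhase :=
  hh.contDiffOn_totalD.continuousOn_fderivWithin uniqueDiffOn_timePhase le_rfl

theorem hasFDerivWithinAt (hh : IsRegular h) {p : ℝ × ℝ × ℝ} (hp : p ∈ timePhase) :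
    HasFDerivWithinAt (fun p : ℝ × ℝ × ℝ => h p.1 p.2.1 p.2.2) (totalD h p) timePhase p :=
  ((hh.contDiffOn.differentiableOn (by norm_num)) p hp).hasFDerivWithinAt

theorem hasFDerivWithinAt_totalD (hh : IsRegular h) {p : ℝ × ℝ × ℝ} (hp : p ∈ timePhase)
    (e : ℝ × ℝ × ℝ) :
    HasFDerivWithinAt (fun p => totalD h p e) ((totalD2 h p).flip e) timePhase p := by
  have h1 := ((hh.contDiffOn_totalD.differentiableOn (by norm_num)) p hp).hasFDerivWithinAt
  exact (ContinuousLinearMap.apply ℝ ℝ e).hasFDerivAt.comp_hasFDerivWithinAt p h1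

theorem totalD2_symm (hh : IsRegular h) {p : ℝ × ℝ × ℝ} (hp : p ∈ timePhase)
    (e f : ℝ × ℝ × ℝ) : totalD2 h p e f = totalD2 h p f e :=
  (hh.contDiffOn p hp).isSymmSndFDerivWithinAt (by simp) uniqueDiffOn_timePhase
    (timePhase_subset_closure_interior hp) hp e f

theorem uniqueDiffWithinAt_unit {x : ℝ} (hx : x ∈ Icc (0 : ℝ) 1) :
    UniqueDiffWithinAt ℝ (Icc (0 : ℝ) 1) x := uniqueDiffOn_Icc zero_lt_one x hx

theorem partialT_eq (hh : IsRegular h) (ht : 0 < t) (hx : x ∈ Icc (0 : ℝ) 1) (v : ℝ) :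
    partialT h t x v = totalD h (t, x, v) (1, 0, 0) :=
  (HasFDerivWithinAt.hasDerivAt_time (hh.hasFDerivWithinAt (mem_timePhase ht hx)) ht hx).deriv

theorem partialX_eq (hh : IsRegular h) (ht : 0 < t) (hx : x ∈ Icc (0 : ℝ) 1) (v : ℝ) :
    partialX (h t) x v = totalD h (t, x, v) (0, 1, 0) :=
  (HasFDerivWithinAt.hasDerivWithinAt_space
    (hh.hasFDerivWithinAt (mem_timePhase ht hx)) ht).derivWithin (uniqueDiffWithinAt_unit hx)

theorem partialV_eq (hh : IsRegular h) (ht : 0 < t) (hx : x ∈ Icc (0 : ℝ) 1) (v : ℝ) :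
    partialV (h t) x v = totalD h (t, x, v) (0, 0, 1) :=
  (HasFDerivWithinAt.hasDerivAt_velocity (hh.hasFDerivWithinAt (mem_timePhase ht hx)) ht hx).deriv

theorem hasDerivAt_time (hh : IsRegular h) (ht : 0 < t) (hx : x ∈ Icc (0 : ℝ) 1) (v : ℝ) :
    HasDerivAt (fun s => h s x v) (partialT h t x v) t := by
  rw [hh.partialT_eq ht hx]
  exact HasFDerivWithinAt.hasDerivAt_time (hh.hasFDerivWithinAt (mem_timePhase ht hx)) ht hx

theorem hasDerivWithinAt_space (hh : IsRegular h) (ht : 0 < t) (hx : x ∈ Icc (0 : ℝ) 1) (v : ℝ) :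
    HasDerivWithinAt (fun y => h t y v) (partialX (h t) x v) (Icc 0 1) x := by
  rw [hh.partialX_eq ht hx]
  exact HasFDerivWithinAt.hasDerivWithinAt_space (hh.hasFDerivWithinAt (mem_timePhase ht hx)) ht

theorem hasDerivAt_velocity (hh : IsRegular h) (ht : 0 < t) (hx : x ∈ Icc (0 : ℝ) 1) (v : ℝ) :
    HasDerivAt (h t x) (partialV (h t) x v) v := by
  rw [hh.partialV_eq ht hx]
  exact HasFDerivWithinAt.hasDerivAt_velocity (hh.hasFDerivWithinAt (mem_timePhase ht hx)) ht hx

theorem hasDerivWithinAt_partialT_aux (hh : IsRegular h) (ht : 0 < t) (hx : x ∈ Icc (0 : ℝ) 1) (v : ℝ) :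
    HasDerivWithinAt (fun y => partialT h t y v) (totalD2 h (t, x, v) (0, 1, 0) (1, 0, 0))
      (Icc 0 1) x :=
  (HasFDerivWithinAt.hasDerivWithinAt_space
    (hh.hasFDerivWithinAt_totalD (mem_timePhase ht hx) (1, 0, 0)) ht).congr
    (fun _ hy => hh.partialT_eq ht hy v) (hh.partialT_eq ht hx v)

theorem hasDerivWithinAt_partialX_aux (hh : IsRegular h) (ht : 0 < t) (hx : x ∈ Icc (0 : ℝ) 1)
    (v : ℝ) :
    HasDerivWithinAt (fun y => partialX (h t) y v) (totalD2 h (t, x, v) (0, 1, 0) (0, 1, 0))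
      (Icc 0 1) x :=
  (HasFDerivWithinAt.hasDerivWithinAt_space
    (hh.hasFDerivWithinAt_totalD (mem_timePhase ht hx) (0, 1, 0)) ht).congr
    (fun _ hy => hh.partialX_eq ht hy v) (hh.partialX_eq ht hx v)

theorem hasDerivWithinAt_partialV_aux (hh : IsRegular h) (ht : 0 < t) (hx : x ∈ Icc (0 : ℝ) 1)
    (v : ℝ) :
    HasDerivWithinAt (fun y => partialV (h t) y v) (totalD2 h (t, x, v) (0, 1, 0) (0, 0, 1))
      (Icc 0 1) x :=
  (HasFDerivWithinAt.hasDerivWithinAt_space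
    (hh.hasFDerivWithinAt_totalD (mem_timePhase ht hx) (0, 0, 1)) ht).congr
    (fun _ hy => hh.partialV_eq ht hy v) (hh.partialV_eq ht hx v)

theorem partialXT_eq (hh : IsRegular h) (ht : 0 < t) (hx : x ∈ Icc (0 : ℝ) 1) (v : ℝ) :
    partialX (partialT h t) x v = totalD2 h (t, x, v) (0, 1, 0) (1, 0, 0) :=
  (hh.hasDerivWithinAt_partialT_aux ht hx v).derivWithin (uniqueDiffWithinAt_unit hx)

theorem partialXX_eq (hh : IsRegular h) (ht : 0 < t) (hx : x ∈ Icc (0 : ℝ) 1) (v : ℝ) :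
    partialX (partialX (h t)) x v = totalD2 h (t, x, v) (0, 1, 0) (0, 1, 0) :=
  (hh.hasDerivWithinAt_partialX_aux ht hx v).derivWithin (uniqueDiffWithinAt_unit hx)

theorem partialXV_eq (hh : IsRegular h) (ht : 0 < t) (hx : x ∈ Icc (0 : ℝ) 1) (v : ℝ) :
    partialX (partialV (h t)) x v = totalD2 h (t, x, v) (0, 1, 0) (0, 0, 1) :=
  (hh.hasDerivWithinAt_partialV_aux ht hx v).derivWithin (uniqueDiffWithinAt_unit hx)

theorem hasDerivWithinAt_partialT (hh : IsRegular h) (ht : 0 < t) (hx : x ∈ Icc (0 : ℝ) 1)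
    (v : ℝ) : HasDerivWithinAt (fun y => partialT h t y v) (partialX (partialT h t) x v)
      (Icc 0 1) x := by
  rw [hh.partialXT_eq ht hx]
  exact hh.hasDerivWithinAt_partialT_aux ht hx v

theorem hasDerivWithinAt_partialX (hh : IsRegular h) (ht : 0 < t) (hx : x ∈ Icc (0 : ℝ) 1)
    (v : ℝ) : HasDerivWithinAt (fun y => partialX (h t) y v) (partialX (partialX (h t)) x v)
      (Icc 0 1) x := by
  rw [hh.partialXX_eq ht hx]
  exact hh.hasDerivWithinAt_partialX_aux ht hx v

theorem hasDerivWithinAt_partialV (hh : IsRegular h) (ht : 0 < t) (hx : x ∈ Icc (0 : ℝ) 1)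
    (v : ℝ) : HasDerivWithinAt (fun y => partialV (h t) y v) (partialX (partialV (h t)) x v)
      (Icc 0 1) x := by
  rw [hh.partialXV_eq ht hx]
  exact hh.hasDerivWithinAt_partialV_aux ht hx v

/-- By symmetry of the second derivative, the time derivative of ∂ₓh is ∂ₓ∂ₜh, for which the
definition of a strong solution provides a bound. -/
theorem hasDerivAt_time_partialX (hh : IsRegular h) (ht : 0 < t) (hx : x ∈ Icc (0 : ℝ) 1)
    (v : ℝ) : HasDerivAt (fun s => partialX (h s) x v) (partialX (partialT h t) x v) t := by
  rw [hh.partialXT_eq ht hx, hh.totalD2_symm (mem_timePhase ht hx)]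
  refine (HasFDerivWithinAt.hasDerivAt_time
    (hh.hasFDerivWithinAt_totalD (mem_timePhase ht hx) (0, 1, 0)) ht hx).congr_of_eventuallyEq ?_
  filter_upwards [Ioi_mem_nhds ht] with s hs
  exact hh.partialX_eq hs hx v

theorem hasDerivAt_velocity_partialX (hh : IsRegular h) (ht : 0 < t) (hx : x ∈ Icc (0 : ℝ) 1)
    (v : ℝ) : HasDerivAt (partialX (h t) x) (partialX (partialV (h t)) x v) v := by
  rw [hh.partialXV_eq ht hx, hh.totalD2_symm (mem_timePhase ht hx)]
  refine (HasFDerivWithinAt.hasDerivAt_velocity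
    (hh.hasFDerivWithinAt_totalD (mem_timePhase ht hx) (0, 1, 0)) ht hx).congr_of_eventuallyEq ?_
  exact Eventually.of_forall fun w => hh.partialX_eq ht hx w

theorem exists_hasDerivAt_velocity_partialV (hh : IsRegular h) (ht : 0 < t)
    (hx : x ∈ Icc (0 : ℝ) 1) :
    ∃ k : ℝ → ℝ, ∀ v, HasDerivAt (partialV (h t) x) (k v) v := by
  refine ⟨fun v => totalD2 h (t, x, v) (0, 0, 1) (0, 0, 1), fun v => ?_⟩
  refine (HasFDerivWithinAt.hasDerivAt_velocity
    (hh.hasFDerivWithinAt_totalD (mem_timePhase ht hx) (0, 0, 1)) ht hx).congr_of_eventuallyEq ?_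
  exact Eventually.of_forall fun w => hh.partialV_eq ht hx w

theorem continuousOn (hh : IsRegular h) :
    ContinuousOn (fun p : ℝ × ℝ × ℝ => h p.1 p.2.1 p.2.2) timePhase := hh.contDiffOn.continuousOn

theorem continuousOn_totalD_apply (hh : IsRegular h) (e : ℝ × ℝ × ℝ) :
    ContinuousOn (fun p => totalD h p e) timePhase :=
  hh.contDiffOn_totalD.continuousOn.clm_apply continuousOn_const

theorem continuousOn_totalD2_apply (hh : IsRegular h) (e f : ℝ × ℝ × ℝ) :
    ContinuousOn (fun p => totalD2 h p e f) timePhase :=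
  (hh.continuousOn_totalD2.clm_apply continuousOn_const).clm_apply continuousOn_const

theorem continuousOn_partialT (hh : IsRegular h) :
    ContinuousOn (fun p : ℝ × ℝ × ℝ => partialT h p.1 p.2.1 p.2.2) timePhase :=
  (hh.continuousOn_totalD_apply (1, 0, 0)).congr fun _ hp => hh.partialT_eq hp.1 hp.2.1 _

theorem continuousOn_partialX (hh : IsRegular h) :
    ContinuousOn (fun p : ℝ × ℝ × ℝ => partialX (h p.1) p.2.1 p.2.2) timePhase :=
  (hh.continuousOn_totalD_apply (0, 1, 0)).congr fun _ hp => hh.partialX_eq hp.1 hp.2.1 _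

theorem continuousOn_partialV (hh : IsRegular h) :
    ContinuousOn (fun p : ℝ × ℝ × ℝ => partialV (h p.1) p.2.1 p.2.2) timePhase :=
  (hh.continuousOn_totalD_apply (0, 0, 1)).congr fun _ hp => hh.partialV_eq hp.1 hp.2.1 _

theorem continuousOn_partialXT (hh : IsRegular h) :
    ContinuousOn (fun p : ℝ × ℝ × ℝ => partialX (partialT h p.1) p.2.1 p.2.2) timePhase :=
  (hh.continuousOn_totalD2_apply (0, 1, 0) (1, 0, 0)).congr
    fun _ hp => hh.partialXT_eq hp.1 hp.2.1 _

theorem continuousOn_partialXX (hh : IsRegular h) :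
    ContinuousOn (fun p : ℝ × ℝ × ℝ => partialX (partialX (h p.1)) p.2.1 p.2.2) timePhase :=
  (hh.continuousOn_totalD2_apply (0, 1, 0) (0, 1, 0)).congr
    fun _ hp => hh.partialXX_eq hp.1 hp.2.1 _

theorem continuousOn_partialXV (hh : IsRegular h) :
    ContinuousOn (fun p : ℝ × ℝ × ℝ => partialX (partialV (h p.1)) p.2.1 p.2.2) timePhase :=
  (hh.continuousOn_totalD2_apply (0, 1, 0) (0, 0, 1)).congr
    fun _ hp => hh.partialXV_eq hp.1 hp.2.1 _

end IsRegular

theorem continuous_velocity_slice {G : ℝ × ℝ × ℝ → ℝ} (hG : ContinuousOn G timePhase) (ht : 0 < t)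
    (hx : x ∈ Icc (0 : ℝ) 1) : Continuous fun v => G (t, x, v) :=
  hG.comp_continuous (by fun_prop) fun _ => mem_timePhase ht hx

theorem continuousOn_space_slice {G : ℝ × ℝ × ℝ → ℝ} (hG : ContinuousOn G timePhase) (ht : 0 < t)
    (v : ℝ) : ContinuousOn (fun y => G (t, y, v)) (Icc 0 1) :=
  hG.comp (by fun_prop) fun _ hy => mem_timePhase ht hy

theorem continuousOn_phase_slice {G : ℝ × ℝ × ℝ → ℝ} (hG : ContinuousOn G timePhase) (ht : 0 < t) :
    ContinuousOn (fun p : ℝ × ℝ => G (t, p.1, p.2)) phaseSpace :=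
  hG.comp (by fun_prop) fun _ hp => mem_timePhase ht hp.1

end Regularity

/-! ### Square integrability in v of the solution and its derivatives. -/

section Dominated

/-- The functions `(1+|v|)h`, `(1+|v|)∂ₓh` and the other derivatives in the definition of a strong
solution are bounded by `B(v)` at the time `t`. -/
structure DominatedAt (h : ℝ → ℝ → ℝ → ℝ) (B : ℝ → ℝ) (t : ℝ) : Prop where
  val : ∀ x ∈ Icc (0 : ℝ) 1, ∀ v, |h t x v| ≤ B v
  mul_val : ∀ x ∈ Icc (0 : ℝ) 1, ∀ v, |v * h t x v| ≤ B v
  dx : ∀ x ∈ Icc (0 : ℝ) 1, ∀ v, |partialX (h t) x v| ≤ B v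
  mul_dx : ∀ x ∈ Icc (0 : ℝ) 1, ∀ v, |v * partialX (h t) x v| ≤ B v
  dv : ∀ x ∈ Icc (0 : ℝ) 1, ∀ v, |partialV (h t) x v| ≤ B v
  dt : ∀ x ∈ Icc (0 : ℝ) 1, ∀ v, |partialT h t x v| ≤ B v
  dxx : ∀ x ∈ Icc (0 : ℝ) 1, ∀ v, |partialX (partialX (h t)) x v| ≤ B v
  dxv : ∀ x ∈ Icc (0 : ℝ) 1, ∀ v, |partialX (partialV (h t)) x v| ≤ B v
  dxt : ∀ x ∈ Icc (0 : ℝ) 1, ∀ v, |partialX (partialT h t) x v| ≤ B v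

variable {h : ℝ → ℝ → ℝ → ℝ} {B : ℝ → ℝ} {t x : ℝ}

theorem IsRegular.exists_dominatedAt (hh : IsRegular h) {τ : ℝ} (T : ℝ) (hτ : 0 < τ) :
    ∃ B : ℝ → ℝ, MemLp B 2 volume ∧ ∀ t ∈ Icc τ T, DominatedAt h B t := by
  obtain ⟨B, hB, hb⟩ := hh.dominated τ T hτ
  have h1 : ∀ v y b : ℝ, (1 + |v|) * |y| ≤ b → |y| ≤ b := fun v y b hyb => by
    nlinarith [mul_nonneg (abs_nonneg v) (abs_nonneg y)]
  have h2 : ∀ v y b : ℝ, (1 + |v|) * |y| ≤ b → |v * y| ≤ b := fun v y b hyb => by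
    rw [abs_mul]
    nlinarith [abs_nonneg y]
  refine ⟨B, hB, fun t ht => ⟨?_, ?_, ?_, ?_, ?_, ?_, ?_, ?_, ?_⟩⟩ <;> intro x hx v <;>
    obtain ⟨b1, b2, b3, b4, b5, b6, b7⟩ := hb t ht x hx v
  exacts [h1 _ _ _ b1, h2 _ _ _ b1, h1 _ _ _ b2, h2 _ _ _ b2, b3, b4, b5, b6, b7]

namespace IsRegular

theorem continuous_val (hh : IsRegular h) (ht : 0 < t) (hx : x ∈ Icc (0 : ℝ) 1) :
    Continuous (h t x) := continuous_velocity_slice hh.continuousOn ht hx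

theorem continuous_dx (hh : IsRegular h) (ht : 0 < t) (hx : x ∈ Icc (0 : ℝ) 1) :
    Continuous (partialX (h t) x) := continuous_velocity_slice hh.continuousOn_partialX ht hx

theorem continuous_dv (hh : IsRegular h) (ht : 0 < t) (hx : x ∈ Icc (0 : ℝ) 1) :
    Continuous (partialV (h t) x) := continuous_velocity_slice hh.continuousOn_partialV ht hx

theorem continuous_dt (hh : IsRegular h) (ht : 0 < t) (hx : x ∈ Icc (0 : ℝ) 1) :
    Continuous (partialT h t x) := continuous_velocity_slice hh.continuousOn_partialT ht hx

theorem continuous_dxx (hh : IsRegular h) (ht : 0 < t) (hx : x ∈ Icc (0 : ℝ) 1) :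
    Continuous (partialX (partialX (h t)) x) :=
  continuous_velocity_slice hh.continuousOn_partialXX ht hx

theorem continuous_dxv (hh : IsRegular h) (ht : 0 < t) (hx : x ∈ Icc (0 : ℝ) 1) :
    Continuous (partialX (partialV (h t)) x) :=
  continuous_velocity_slice hh.continuousOn_partialXV ht hx

theorem continuous_dxt (hh : IsRegular h) (ht : 0 < t) (hx : x ∈ Icc (0 : ℝ) 1) :
    Continuous (partialX (partialT h t) x) :=
  continuous_velocity_slice hh.continuousOn_partialXT ht hx

end IsRegular

variable (hh : IsRegular h) (hB : MemLp B 2 volume) (hd : DominatedAt h B t) (ht : 0 < t)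
  (hx : x ∈ Icc (0 : ℝ) 1)

include hh hB hd ht hx

namespace DominatedAt

theorem memLp_val : MemLp (h t x) 2 volume :=
  memLp_of_bound hB (hh.continuous_val ht hx).aestronglyMeasurable (hd.val x hx)

theorem memLp_mul_val : MemLp (fun v => v * h t x v) 2 volume :=
  memLp_of_bound hB (continuous_id.mul (hh.continuous_val ht hx)).aestronglyMeasurable
    (hd.mul_val x hx)

theorem memLp_dx : MemLp (partialX (h t) x) 2 volume :=
  memLp_of_bound hB (hh.continuous_dx ht hx).aestronglyMeasurable (hd.dx x hx)

theorem memLp_mul_dx : MemLp (fun v => v * partialX (h t) x v) 2 volume :=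
  memLp_of_bound hB (continuous_id.mul (hh.continuous_dx ht hx)).aestronglyMeasurable
    (hd.mul_dx x hx)

theorem memLp_dv : MemLp (partialV (h t) x) 2 volume :=
  memLp_of_bound hB (hh.continuous_dv ht hx).aestronglyMeasurable (hd.dv x hx)

theorem memLp_dt : MemLp (partialT h t x) 2 volume :=
  memLp_of_bound hB (hh.continuous_dt ht hx).aestronglyMeasurable (hd.dt x hx)

theorem memLp_dxv : MemLp (partialX (partialV (h t)) x) 2 volume :=
  memLp_of_bound hB (hh.continuous_dxv ht hx).aestronglyMeasurable (hd.dxv x hx)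

end DominatedAt

end Dominated

/-! ### The Fokker-Planck operator in terms of A = ∂ᵥ + v/2. -/

section WeakForm

/-- Test functions of the velocity, with derivative `φ'`, for the weak form of the equation. -/
structure IsTest (φ φ' : ℝ → ℝ) : Prop where
  hasDerivAt : ∀ v, HasDerivAt φ (φ' v) v
  continuous' : Continuous φ'
  memLp : MemLp φ 2 volume
  memLp_mul : MemLp (fun v => v * φ v) 2 volume
  memLp' : MemLp φ' 2 volume

/-- The annihilation operator `∂ᵥ + v/2`, applied to a function with derivative `φ'`. -/
noncomputable def annih (φ φ' : ℝ → ℝ) (v : ℝ) : ℝ := φ' v + v / 2 * φ v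

theorem IsTest.memLp_annih {φ φ' : ℝ → ℝ} (hφ : IsTest φ φ') : MemLp (annih φ φ') 2 volume := by
  refine (hφ.memLp'.add (hφ.memLp_mul.const_mul (1 / 2))).ae_eq (Eventually.of_forall fun v => ?_)
  simp only [annih, Pi.add_apply]
  ring

theorem isTest_sqrtM : IsTest sqrtM fun v => -(v / 2) * sqrtM v where
  hasDerivAt := hasDerivAt_sqrtM
  continuous' := by
    have := continuous_sqrtM
    fun_prop
  memLp := memLp_sqrtM
  memLp_mul := memLp_mul_sqrtM
  memLp' := by
    refine (memLp_mul_sqrtM.const_mul (-(1 / 2))).ae_eq (Eventually.of_forall fun v => ?_)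
    simp only
    ring

theorem annih_sqrtM (v : ℝ) : annih sqrtM (fun v => -(v / 2) * sqrtM v) v = 0 := by
  simp [annih]

theorem isTest_mul_sqrtM :
    IsTest (fun v => v * sqrtM v) fun v => sqrtM v + v * (-(v / 2) * sqrtM v) where
  hasDerivAt v := ((hasDerivAt_id v).mul (hasDerivAt_sqrtM v)).congr_deriv (by simp)
  continuous' := by
    have := continuous_sqrtM
    fun_prop
  memLp := memLp_mul_sqrtM
  memLp_mul := by
    refine (memLp_pow_mul_sqrtM 2).ae_eq (Eventually.of_forall fun v => ?_)
    simp only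
    ring
  memLp' := by
    refine (memLp_sqrtM.add ((memLp_pow_mul_sqrtM 2).const_mul (-(1 / 2)))).ae_eq
      (Eventually.of_forall fun v => ?_)
    simp only [Pi.add_apply]
    ring

theorem annih_mul_sqrtM (v : ℝ) :
    annih (fun v => v * sqrtM v) (fun v => sqrtM v + v * (-(v / 2) * sqrtM v)) v = sqrtM v := by
  simp only [annih]
  ring

/-- This is the factorization 𝓛 = (∂ᵥ - v/2)(∂ᵥ + v/2), with ∂ᵥ(Af) expanded. It comes from M
∂ᵥ(f/√M) = √M Af. -/
theorem linFP_eq {f f₁ f₂ : ℝ → ℝ} (hf : ∀ v, HasDerivAt f (f₁ v) v)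
    (hf₁ : ∀ v, HasDerivAt f₁ (f₂ v) v) (v : ℝ) :
    linFP f v = f₂ v + (1 / 2 * f v + v / 2 * f₁ v) - v / 2 * annih f f₁ v := by
  have h1 : (fun w => maxwellian w * deriv (fun z => f z / √(maxwellian z)) w)
      = fun w => sqrtM w * annih f f₁ w := by
    ext w
    have hd := (hf w).div (hasDerivAt_sqrtM w) (sqrtM_pos w).ne'
    have he : (fun z => f z / √(maxwellian z)) = f / sqrtM := rfl
    rw [he, hd.deriv, ← sqrtM_sq, annih]
    have := (sqrtM_pos w).ne'
    field_simp
    ring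
  have h2 : HasDerivAt (fun w => sqrtM w * annih f f₁ w)
      (-(v / 2) * sqrtM v * annih f f₁ v
        + sqrtM v * (f₂ v + (1 / 2 * f v + v / 2 * f₁ v))) v :=
    (hasDerivAt_sqrtM v).mul
      ((hf₁ v).add (((hasDerivAt_id v).div_const 2).mul (hf v)))
  unfold linFP
  rw [h1, h2.deriv]
  change _ / sqrtM v = _
  have := (sqrtM_pos v).ne'
  field_simp
  ring

/-- Integration by parts: ∂ᵥ - v/2 is minus the adjoint of A. -/
theorem integral_annih_mul_eq {f f₁ φ φ' : ℝ → ℝ} (hf : IsTest f f₁) (hφ : IsTest φ φ') :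
    ∫ v, (f₁ v - v / 2 * f v) * φ v = -∫ v, f v * annih φ φ' v := by
  have i1 := hf.memLp'.integrable_mul_two hφ.memLp
  have i2 := hf.memLp.integrable_mul_two hφ.memLp'
  have i3 := hf.memLp.integrable_mul_two hφ.memLp
  have i4 : Integrable fun v => f v * ((1 / 2) * (v * φ v)) :=
    hf.memLp.integrable_mul_two (hφ.memLp_mul.const_mul _)
  have hp := integral_mul_deriv_eq_deriv_mul_of_integrable (u := f) (v := φ) (u' := f₁) (v' := φ')
    (fun v _ => hf.hasDerivAt v) (fun v _ => hφ.hasDerivAt v) i2 i1 i3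
  have e1 : ∀ v, (f₁ v - v / 2 * f v) * φ v = f₁ v * φ v - f v * ((1 / 2) * (v * φ v)) :=
    fun v => by ring
  have e2 : ∀ v, f v * annih φ φ' v = f v * φ' v + f v * ((1 / 2) * (v * φ v)) :=
    fun v => by rw [annih]; ring
  simp_rw [e1, e2]
  rw [integral_sub i1 i4, integral_add i2 i4, hp]
  ring

/-- The weak form of the Fokker-Planck operator. -/
theorem integral_linFP_mul {f f₁ f₂ φ φ' : ℝ → ℝ} (hf : IsTest f f₁)
    (hf₁ : ∀ v, HasDerivAt f₁ (f₂ v) v) (hL : MemLp (linFP f) 2 volume) (hφ : IsTest φ φ') :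
    ∫ v, linFP f v * φ v = -∫ v, annih f f₁ v * annih φ φ' v := by
  have hk := hf.memLp_annih
  have hkd : ∀ v, HasDerivAt (annih f f₁) (f₂ v + (1 / 2 * f v + v / 2 * f₁ v)) v := fun v =>
    (hf₁ v).add (((hasDerivAt_id v).div_const 2).mul (hf.hasDerivAt v))
  have i1 := hL.integrable_mul_two hφ.memLp
  have i2 : Integrable fun v => annih f f₁ v * ((1 / 2) * (v * φ v)) :=
    hk.integrable_mul_two (hφ.memLp_mul.const_mul _)
  have i3 := hk.integrable_mul_two hφ.memLp
  have i4 := hk.integrable_mul_two hφ.memLp'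
  -- No integrability of f'' is assumed. That of (Af)'φ is recovered from 𝓛f, Af and vφ being square
  -- integrable.
  have e : ∀ v, (f₂ v + (1 / 2 * f v + v / 2 * f₁ v)) * φ v
      = linFP f v * φ v + annih f f₁ v * ((1 / 2) * (v * φ v)) := fun v => by
    rw [linFP_eq hf.hasDerivAt hf₁]
    ring
  have i5 : Integrable fun v => (f₂ v + (1 / 2 * f v + v / 2 * f₁ v)) * φ v := by
    simp_rw [e]
    exact i1.add i2
  have hp := integral_mul_deriv_eq_deriv_mul_of_integrable (u := annih f f₁) (v := φ)
    (u' := fun v => f₂ v + (1 / 2 * f v + v / 2 * f₁ v)) (v' := φ')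
    (fun v _ => hkd v) (fun v _ => hφ.hasDerivAt v) i4 i5 i3
  simp_rw [e] at hp
  rw [integral_add i1 i2] at hp
  have e2 : ∀ v, annih f f₁ v * annih φ φ' v
      = annih f f₁ v * φ' v + annih f f₁ v * ((1 / 2) * (v * φ v)) := fun v => by
    rw [annih, annih]
    ring
  simp_rw [e2]
  rw [integral_add i4 i2, hp]
  ring

end WeakForm

/-! ### The kinetic equation and its x-derivative, tested in the velocity. -/

section WeakEquation

variable {h : ℝ → ℝ → ℝ → ℝ} {B : ℝ → ℝ} {t x : ℝ}

theorem DominatedAt.isTest_val (hh : IsRegular h) (hB : MemLp B 2 volume) (hd : DominatedAt h B t)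
    (ht : 0 < t) (hx : x ∈ Icc (0 : ℝ) 1) : IsTest (h t x) (partialV (h t) x) where
  hasDerivAt := hh.hasDerivAt_velocity ht hx
  continuous' := hh.continuous_dv ht hx
  memLp := hd.memLp_val hh hB ht hx
  memLp_mul := hd.memLp_mul_val hh hB ht hx
  memLp' := hd.memLp_dv hh hB ht hx

theorem DominatedAt.isTest_dx (hh : IsRegular h) (hB : MemLp B 2 volume) (hd : DominatedAt h B t)
    (ht : 0 < t) (hx : x ∈ Icc (0 : ℝ) 1) :
    IsTest (partialX (h t) x) (partialX (partialV (h t)) x) where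
  hasDerivAt := hh.hasDerivAt_velocity_partialX ht hx
  continuous' := hh.continuous_dxv ht hx
  memLp := hd.memLp_dx hh hB ht hx
  memLp_mul := hd.memLp_mul_dx hh hB ht hx
  memLp' := hd.memLp_dxv hh hB ht hx

variable {ε : ℝ} {E : ℝ → ℝ → ℝ} {K : Matrix (Fin 2) (Fin 2) ℝ} {h₀ : ℝ → ℝ → ℝ}

/-- The equation tested against a function of the velocity. -/
theorem IsSolution.weak_equation (hs : IsSolution ε E K h₀ h) (hε : 0 < ε)
    (hB : MemLp B 2 volume) (hd : DominatedAt h B t) (ht : 0 < t) (hx : x ∈ Ioo (0 : ℝ) 1)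
    {φ φ' : ℝ → ℝ} (hφ : IsTest φ φ') :
    ε * (∫ v, partialT h t x v * φ v) + (∫ v, partialX (h t) x v * (v * φ v))
      + 1 / ε * (∫ v, annih (h t x) (partialV (h t) x) v * annih φ φ' v)
      + E t x * (∫ v, h t x v * annih φ φ' v) = 0 := by
  have hh := hs.regular
  have hx' := Ioo_subset_Icc_self hx
  have hT := hd.isTest_val hh hB ht hx'
  have hmt := hd.memLp_dt hh hB ht hx'
  have hmx := hd.memLp_mul_dx hh hB ht hx'
  have hmr : MemLp (fun v => partialV (h t) x v - v / 2 * h t x v) 2 volume := by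
    refine (hT.memLp'.sub (hT.memLp_mul.const_mul (1 / 2))).ae_eq
      (Eventually.of_forall fun v => ?_)
    simp only [Pi.sub_apply]
    ring
  obtain ⟨k, hk⟩ := hh.exists_hasDerivAt_velocity_partialV ht hx'
  -- The equation expresses 𝓛h through terms that are dominated, so 𝓛h is square integrable although
  -- ∂ᵥ²h has no assumed bound.
  have hL : ∀ v, linFP (h t x) v = ε * ε * partialT h t x v + ε * (v * partialX (h t) x v)
      - ε * E t x * (partialV (h t) x v - v / 2 * h t x v) := fun v => by
    have := hs.equation t ht x hx v
    field_simp at this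
    linear_combination (-1 / 2) * this
  have hLm : MemLp (linFP (h t x)) 2 volume :=
    ((((hmt.const_mul (ε * ε)).add (hmx.const_mul ε)).sub (hmr.const_mul (ε * E t x)))).ae_eq
      (Eventually.of_forall fun v => (hL v).symm)
  have hw := integral_linFP_mul hT hk hLm hφ
  have hr := integral_annih_mul_eq hT hφ
  have i1 : Integrable fun v => ε * ε * (partialT h t x v * φ v) :=
    (hmt.integrable_mul_two hφ.memLp).const_mul _
  have i2 : Integrable fun v => ε * (partialX (h t) x v * (v * φ v)) :=
    ((hd.memLp_dx hh hB ht hx').integrable_mul_two hφ.memLp_mul).const_mul _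
  have i3 : Integrable fun v => ε * E t x * ((partialV (h t) x v - v / 2 * h t x v) * φ v) :=
    (hmr.integrable_mul_two hφ.memLp).const_mul _
  have i12 : Integrable fun v => ε * ε * (partialT h t x v * φ v)
      + ε * (partialX (h t) x v * (v * φ v)) := i1.add i2
  have e : ∀ v, linFP (h t x) v * φ v = ε * ε * (partialT h t x v * φ v)
      + ε * (partialX (h t) x v * (v * φ v))
      - ε * E t x * ((partialV (h t) x v - v / 2 * h t x v) * φ v) := fun v => by
    rw [hL]
    ring
  simp_rw [e] at hw
  rw [integral_sub i12 i3, integral_add i1 i2, integral_const_mul, integral_const_mul,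
    integral_const_mul, hr] at hw
  have h1 : ε * (1 / ε) = 1 := by field_simp
  refine mul_left_cancel₀ hε.ne' ?_
  linear_combination hw
    + (∫ v, annih (h t x) (partialV (h t) x) v * annih φ φ' v) * h1

theorem DominatedAt.memLp_annih_val (hh : IsRegular h) (hB : MemLp B 2 volume)
    (hd : DominatedAt h B t) (ht : 0 < t) (hx : x ∈ Icc (0 : ℝ) 1) :
    MemLp (annih (h t x) (partialV (h t) x)) 2 volume :=
  (hd.isTest_val hh hB ht hx).memLp_annih

/-- The `x`-derivative of the equation tested against a function of the velocity. -/
theorem IsSolution.weak_equation_dx (hs : IsSolution ε E K h₀ h) (hε : 0 < ε)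
    (hE : ContDiffOn ℝ 3 (E t) (Icc 0 1))
    (hB : MemLp B 2 volume) (hd : DominatedAt h B t) (ht : 0 < t) (hx : x ∈ Ioo (0 : ℝ) 1)
    {φ φ' : ℝ → ℝ} (hφ : IsTest φ φ') :
    ε * (∫ v, partialX (partialT h t) x v * φ v)
      + (∫ v, partialX (partialX (h t)) x v * (v * φ v))
      + 1 / ε * (∫ v, annih (partialX (h t) x) (partialX (partialV (h t)) x) v * annih φ φ' v)
      + (dx (E t) x * (∫ v, h t x v * annih φ φ' v)
        + E t x * (∫ v, partialX (h t) x v * annih φ φ' v)) = 0 := by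
  have hh := hs.regular
  have hx' := Ioo_subset_Icc_self hx
  have hI : Convex ℝ (Icc (0 : ℝ) 1) := convex_Icc 0 1
  have d1 := hasDerivWithinAt_integral_mul_const hI hx' (F := fun y v => partialT h t y v)
    (F' := fun y v => partialX (partialT h t) y v) hB hφ.memLp
    (fun y hy => hd.memLp_dt hh hB ht hy) (fun y hy v => hh.hasDerivWithinAt_partialT ht hy v)
    hd.dxt
  have d2 := hasDerivWithinAt_integral_mul_const hI hx' (F := fun y v => partialX (h t) y v)
    (F' := fun y v => partialX (partialX (h t)) y v) hB hφ.memLp_mul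
    (fun y hy => hd.memLp_dx hh hB ht hy) (fun y hy v => hh.hasDerivWithinAt_partialX ht hy v)
    hd.dxx
  have d3 := hasDerivWithinAt_integral_mul_const hI hx'
    (F := fun y v => annih (h t y) (partialV (h t) y) v)
    (F' := fun y v => annih (partialX (h t) y) (partialX (partialV (h t)) y) v)
    (hB.const_mul 2) hφ.memLp_annih
    (fun y hy => hd.memLp_annih_val hh hB ht hy)
    (fun y hy v => (hh.hasDerivWithinAt_partialV ht hy v).add
      ((hh.hasDerivWithinAt_space ht hy v).const_mul (v / 2)))
    (fun y hy v => by
      have b1 := hd.dxv y hy v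
      have b2 := hd.mul_dx y hy v
      rw [abs_le] at b1 b2 ⊢
      simp only [annih]
      constructor <;> linarith [b1.1, b1.2, b2.1, b2.2])
  have d4 := hasDerivWithinAt_integral_mul_const hI hx' (F := fun y v => h t y v)
    (F' := fun y v => partialX (h t) y v) hB hφ.memLp_annih
    (fun y hy => hd.memLp_val hh hB ht hy) (fun y hy v => hh.hasDerivWithinAt_space ht hy v)
    hd.dx
  have dE : HasDerivWithinAt (E t) (dx (E t) x) (Icc 0 1) x :=
    ((hE.differentiableOn (by norm_num)) x hx').hasDerivWithinAt
  -- The tested identity is differentiated in x, rather than the equation itself, which would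
  -- involve ∂ₓ∂ᵥ²h. As the identity is known only for 0 < x < 1, the derivative is taken at an
  -- interior point.
  have hsum := (((d1.const_mul ε).add d2).add (d3.const_mul (1 / ε))).add (dE.mul d4)
  have hsum' := hsum.hasDerivAt (Icc_mem_nhds hx.1 hx.2)
  refine hsum'.unique ((hasDerivAt_const x (0 : ℝ)).congr_of_eventuallyEq ?_)
  filter_upwards [Ioo_mem_nhds hx.1 hx.2] with y hy
  exact hs.weak_equation hε hB hd ht hy hφ

end WeakEquation

/-! ### Splitting off the component along √M. -/

section Fluctuation

variable {f f' g g' ψ : ℝ → ℝ}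

theorem integral_fluctuation_mul (hf : MemLp f 2 volume) (hψ : MemLp ψ 2 volume) (s : ℝ) :
    ∫ v, (f v - s * sqrtM v) * ψ v = (∫ v, f v * ψ v) - s * ∫ v, sqrtM v * ψ v := by
  have e : ∀ v, (f v - s * sqrtM v) * ψ v = f v * ψ v - s * (sqrtM v * ψ v) := fun v => by ring
  simp_rw [e]
  have i : Integrable fun v => s * (sqrtM v * ψ v) :=
    (memLp_sqrtM.integrable_mul_two hψ).const_mul s
  rw [integral_sub (hf.integrable_mul_two hψ) i, integral_const_mul]

theorem memLp_fluctuation (hf : MemLp f 2 volume) (s : ℝ) :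
    MemLp (fun v => f v - s * sqrtM v) 2 volume := hf.sub (memLp_sqrtM.const_mul s)

/-- Pythagoras for the projection onto the unit vector √M. -/
theorem integral_fluctuation_sq (hf : MemLp f 2 volume) :
    ∫ v, (f v - (∫ w, f w * sqrtM w) * sqrtM v) ^ 2
      = (∫ v, f v ^ 2) - (∫ v, f v * sqrtM v) ^ 2 := by
  set s := ∫ w, f w * sqrtM w
  have h1 := integral_fluctuation_mul hf (memLp_fluctuation hf s) s
  have h2 := integral_fluctuation_mul hf hf s
  have h3 := integral_fluctuation_mul hf memLp_sqrtM s
  have e1 : ∫ v, f v * (f v - s * sqrtM v) = ∫ v, (f v - s * sqrtM v) * f v := by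
    simp_rw [mul_comm]
  have e2 : ∫ v, sqrtM v * (f v - s * sqrtM v) = ∫ v, (f v - s * sqrtM v) * sqrtM v := by
    simp_rw [mul_comm]
  have e3 : ∫ v, sqrtM v * f v = s := by simp_rw [s, mul_comm]
  have e4 : ∫ v, sqrtM v * sqrtM v = 1 := by simp_rw [← sq, integral_sqrtM_sq]
  have e5 : ∫ v, f v * f v = ∫ v, f v ^ 2 := by simp_rw [← sq]
  have e6 : ∫ v, (f v - s * sqrtM v) * (f v - s * sqrtM v) = ∫ v, (f v - s * sqrtM v) ^ 2 := by
    simp_rw [← sq]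
  rw [← e6, h1, e1, e2, h2, h3, e3, e4, e5]
  change (∫ v, f v ^ 2) - s * s - s * (s - s * 1) = (∫ v, f v ^ 2) - s ^ 2
  ring

/-- Moments against functions orthogonal to `√M` only see the fluctuation. -/
theorem sq_integral_mul_le_of_orthogonal (hf : MemLp f 2 volume) (hψ : MemLp ψ 2 volume)
    (h0 : ∫ v, sqrtM v * ψ v = 0) :
    (∫ v, f v * ψ v) ^ 2
      ≤ ((∫ v, f v ^ 2) - (∫ v, f v * sqrtM v) ^ 2) * ∫ v, ψ v ^ 2 := by
  have h := sq_integral_mul_le (memLp_fluctuation hf (∫ v, f v * sqrtM v)) hψ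
  rwa [integral_fluctuation_mul hf hψ, h0, mul_zero, sub_zero, integral_fluctuation_sq hf] at h

theorem sq_flux_le (hf : MemLp f 2 volume) :
    (∫ v, f v * (v * sqrtM v)) ^ 2 ≤ (∫ v, f v ^ 2) - (∫ v, f v * sqrtM v) ^ 2 := by
  have h := sq_integral_mul_le_of_orthogonal hf memLp_mul_sqrtM (by
    rw [← integral_sqrtM_mul_mul_sqrtM]
    simp_rw [mul_comm])
  rwa [integral_mul_sqrtM_sq, mul_one] at h

theorem sq_second_moment_le (hf : MemLp f 2 volume) :
    (∫ v, f v * ((v ^ 2 - 1) * sqrtM v)) ^ 2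
      ≤ ((∫ v, f v ^ 2) - (∫ v, f v * sqrtM v) ^ 2) * 2 := by
  have h := sq_integral_mul_le_of_orthogonal hf memLp_sq_sub_one_mul_sqrtM (by
    rw [← integral_sq_sub_one_mul_maxwellian]
    simp_rw [mul_comm])
  rwa [integral_sq_sub_one_mul_sqrtM_sq] at h

/-- With v² = 1 + (v² - 1), the momentum flux splits into the density, which gives the good term
∂ₓσ, and a moment orthogonal to √M. -/
theorem integral_mul_mul_mul_sqrtM (hf : MemLp f 2 volume) :
    ∫ v, f v * (v * (v * sqrtM v))
      = (∫ v, f v * sqrtM v) + ∫ v, f v * ((v ^ 2 - 1) * sqrtM v) := by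
  rw [← integral_add (hf.integrable_mul_two memLp_sqrtM)
    (hf.integrable_mul_two memLp_sq_sub_one_mul_sqrtM)]
  congr 1
  ext v
  ring

/-- Because A*√M = v√M. -/
theorem IsTest.integral_sqrtM_mul_annih (hg : IsTest g g') :
    ∫ v, sqrtM v * annih g g' v = ∫ v, g v * (v * sqrtM v) := by
  have h := integral_annih_mul_eq isTest_sqrtM hg
  rw [eq_comm, neg_eq_iff_eq_neg, ← integral_neg] at h
  rw [h]
  congr 1
  ext v
  ring

/-- The Gaussian Poincaré inequality in the form W ≤ ‖Af‖²: the dissipation controls the squared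
norm of the fluctuation. -/
theorem IsTest.fluctuation_le (hf : IsTest f f') :
    (∫ v, f v ^ 2) - (∫ v, f v * sqrtM v) ^ 2 ≤ ∫ v, annih f f' v ^ 2 := by
  have h := gaussian_poincare hf.hasDerivAt hf.continuous' hf.memLp hf.memLp_annih
  unfold annih
  linarith

/-- The field terms are pairings of f with Ag. Their √M component is a product of density and flux,
kept for a separate Young inequality; the rest is bounded by fluctuation and dissipation alone. -/
theorem IsTest.abs_integral_mul_annih_sub_le (hf : MemLp f 2 volume) (hg : IsTest g g') :
    |(∫ v, f v * annih g g' v) - (∫ v, f v * sqrtM v) * ∫ v, g v * (v * sqrtM v)|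
      ≤ 1 / 2 * (((∫ v, f v ^ 2) - (∫ v, f v * sqrtM v) ^ 2) + ∫ v, annih g g' v ^ 2) := by
  have h := abs_integral_mul_le (memLp_fluctuation hf (∫ v, f v * sqrtM v)) hg.memLp_annih
  rwa [integral_fluctuation_mul hf hg.memLp_annih, hg.integral_sqrtM_mul_annih,
    integral_fluctuation_sq hf] at h

end Fluctuation

/-! ### The hypocoercivity estimate at a fixed position. -/

section Hypocoercivity

/-- The algebraic inequality behind the hypocoercivity estimate. Here `W`, `Z` are the squared norms
of the fluctuations of `h` and `∂ₓh`, `Dh`, `Dg` the dissipations and `δ = 1/ε`. -/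
theorem hypocoercive_inequality
    {δ a c lam Cs ξ σ σx u ux P W Z Dh Dg A₁ A₂ A₃ E E' : ℝ}
    (hδ : 1 ≤ δ) (ha0 : 0 ≤ a) (hc0 : 0 ≤ c) (hc : c ≤ 1 / 64) (hlam : lam ≤ 1 / 4)
    (hCs0 : 0 ≤ Cs) (hCs : Cs ≤ 1) (ha : 4 * a ≤ lam - 2 * c)
    (hξ1 : ξ ≤ δ ^ 2 * (lam - 2 * c - 4 * a))
    (hξ2 : ξ ≤ (a * (3 * Cs - 4 * c) - 8 * c) / 8)
    (hW : 0 ≤ W) (hZ : 0 ≤ Z) (hDh : W ≤ Dh) (hDg : Z ≤ Dg) (hu : u ^ 2 ≤ W) (hux : ux ^ 2 ≤ Z)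
    (hP : P ^ 2 ≤ Z * 2) (hA₁ : |A₁| ≤ 1 / 2 * (W + Dh)) (hA₂ : |A₂| ≤ 1 / 2 * (Z + Dg))
    (hA₃ : |A₃| ≤ 1 / 2 * (W + Dg)) (hE : |E| ≤ c) (hE' : |E'| ≤ c) :
    -δ ^ 2 * (Dh + Dg) - δ * E * (A₁ + σ * u + A₂ + σx * ux) - δ * E' * (A₃ + σ * ux)
      - a * (σx + P) * σx - a * δ * u * σx - a * E * σ * σx + a * ux ^ 2
      + ξ * (W + σ ^ 2 + Z + σx ^ 2) ≤ a * Cs / 2 * (σ ^ 2 - σx ^ 2) := by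
  have bound : ∀ e y z : ℝ, |e| ≤ c → |y| ≤ z → -(e * y) ≤ c * z := fun e y z he hy =>
    (neg_le_abs _).trans (by
      rw [abs_mul]
      exact mul_le_mul he hy (abs_nonneg _) hc0)
  have young : ∀ y z : ℝ, |y * z| ≤ 1 / 2 * (y ^ 2 + z ^ 2) := fun y z => by
    rw [abs_le]
    constructor <;> linarith [add_sq y z, sub_sq y z, sq_nonneg (y + z), sq_nonneg (y - z)]
  have hδ0 : 0 ≤ δ := by linarith
  have hδ2 : δ ≤ δ ^ 2 := le_self_pow₀ hδ two_ne_zero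
  have hδ3 : 1 ≤ δ ^ 2 := by linarith
  have scale : ∀ y z : ℝ, |y| ≤ z → |δ * y| ≤ δ ^ 2 * z := fun y z hy => by
    rw [abs_mul, abs_of_nonneg hδ0]
    exact mul_le_mul hδ2 hy (abs_nonneg _) (by positivity)
  -- The factor δ is always put on the microscopic quantity, where δ² is available from the
  -- dissipation. The densities σ, σx carry no power of δ.
  have t1 := bound E _ _ hE (scale _ _ hA₁)
  have t2 := bound E _ _ hE (young σ (δ * u))
  have t3 := bound E _ _ hE (scale _ _ hA₂)
  have t4 := bound E _ _ hE (young σx (δ * ux))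
  have t5 := bound E' _ _ hE' (scale _ _ hA₃)
  have t6 := bound E' _ _ hE' (young σ (δ * ux))
  -- The weight 1/8 on σx² leaves 7a/8 of the macroscopic dissipation. The price 4P² ≤ 8Z and 4(δu)²
  -- ≤ 4δ²W is paid by the microscopic one.
  have t7 : -(a * P * σx) - a * δ * u * σx ≤ a * (1 / 8 * σx ^ 2 + 4 * P ^ 2 + 4 * (δ * u) ^ 2) := by
    have : 0 ≤ 1 / 8 * σx ^ 2 + 4 * P ^ 2 + 4 * (δ * u) ^ 2 + P * σx + δ * u * σx := by
      linear_combination sq_nonneg (σx / 4 + 2 * P) + sq_nonneg (σx / 4 + 2 * (δ * u))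
    linear_combination mul_nonneg ha0 this
  have t8 := mul_le_mul_of_nonneg_left (bound E _ _ hE (young σ σx)) ha0
  have X0 : 0 ≤ δ ^ 2 := sq_nonneg δ
  have r1 : ξ * W ≤ δ ^ 2 * (lam - 2 * c - 4 * a) * W := mul_le_mul_of_nonneg_right hξ1 hW
  have r2 : ξ * Z ≤ δ ^ 2 * (lam - 2 * c - 4 * a) * Z := mul_le_mul_of_nonneg_right hξ1 hZ
  have r3 : ξ * σ ^ 2 ≤ (a * (3 * Cs - 4 * c) - 8 * c) / 8 * σ ^ 2 :=
    mul_le_mul_of_nonneg_right hξ2 (sq_nonneg _)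
  have r4 : ξ * σx ^ 2 ≤ (a * (3 * Cs - 4 * c) - 8 * c) / 8 * σx ^ 2 :=
    mul_le_mul_of_nonneg_right hξ2 (sq_nonneg _)
  have s1 : 0 ≤ (c / 2 + 4 * a) * (δ ^ 2 * (W - u ^ 2)) :=
    mul_nonneg (by linarith) (mul_nonneg X0 (by linarith))
  have s2 : 0 ≤ c * (δ ^ 2 * (Z - ux ^ 2)) := mul_nonneg hc0 (mul_nonneg X0 (by linarith))
  have s3 : a * ux ^ 2 ≤ a * (δ ^ 2 * Z) :=
    mul_le_mul_of_nonneg_left (hux.trans (le_mul_of_one_le_left hZ hδ3)) ha0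
  have s4 : 4 * a * P ^ 2 ≤ 4 * a * (δ ^ 2 * (Z * 2)) :=
    mul_le_mul_of_nonneg_left (hP.trans (le_mul_of_one_le_left (by linarith) hδ3)) (by linarith)
  -- What remains is slack. For W and Z it comes from the dissipation constant 1 against lam ≤ 1/4,
  -- which with 4a ≤ lam - 2c also covers the total cost 9aδ²Z. For σx² it comes from Cs ≤ 1, for σ²
  -- from 3/8 < 1/2.
  have q1 : 0 ≤ δ ^ 2 * ((1 - c / 2) * (Dh - W)) :=
    mul_nonneg X0 (mul_nonneg (by linarith) (by linarith))
  have q2 : 0 ≤ δ ^ 2 * ((1 - c) * (Dg - Z)) :=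
    mul_nonneg X0 (mul_nonneg (by linarith) (by linarith))
  have q3 : 0 ≤ δ ^ 2 * ((1 - lam) * W) := mul_nonneg X0 (mul_nonneg (by linarith) hW)
  have q4 : 0 ≤ δ ^ 2 * ((1 - lam - 5 * a - c / 2) * Z) :=
    mul_nonneg X0 (mul_nonneg (by linarith) hZ)
  have q5 : 0 ≤ a * ((1 - Cs) * σx ^ 2) :=
    mul_nonneg ha0 (mul_nonneg (by linarith) (sq_nonneg _))
  have q6 : 0 ≤ c * σx ^ 2 := mul_nonneg hc0 (sq_nonneg _)
  have q7 : 0 ≤ a * (Cs * σ ^ 2) := mul_nonneg ha0 (mul_nonneg hCs0 (sq_nonneg _))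
  linear_combination t1 + t2 + t3 + t4 + t5 + t6 + t7 + t8 + r1 + r2 + r3 + r4 + s1 + s2 + s3 + s4
    + q1 + q2 + q3 + q4 + 7 / 8 * q5 + 1 / 2 * q6 + 1 / 8 * q7

variable {h : ℝ → ℝ → ℝ → ℝ} {B : ℝ → ℝ} {t x : ℝ}
  {ε : ℝ} {E : ℝ → ℝ → ℝ} {K : Matrix (Fin 2) (Fin 2) ℝ} {h₀ : ℝ → ℝ → ℝ}

/-- The density of the Lyapunov functional at the position `x`. -/
noncomputable def lyapunovDensity (ε a : ℝ) (h : ℝ → ℝ → ℝ → ℝ) (t x : ℝ) : ℝ :=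
  1 / 2 * ((∫ v, h t x v * h t x v) + ∫ v, partialX (h t) x v * partialX (h t) x v)
    + ε * a * (flux (h t) x * density (partialX (h t)) x)

/-- The time derivative of `lyapunovDensity`. -/
noncomputable def lyapunovDensityDt (ε a : ℝ) (h : ℝ → ℝ → ℝ → ℝ) (t x : ℝ) : ℝ :=
  (∫ v, partialT h t x v * h t x v) + (∫ v, partialX (partialT h t) x v * partialX (h t) x v)
    + ε * a * (flux (partialT h t) x * density (partialX (h t)) x
      + flux (h t) x * density (partialX (partialT h t)) x)

/-- The `x`-derivative of the boundary flux of the Lyapunov functional. -/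
noncomputable def boundaryFluxDx (ε a : ℝ) (h : ℝ → ℝ → ℝ → ℝ) (t x : ℝ) : ℝ :=
  1 / ε * (∫ v, partialX (h t) x v * (v * h t x v))
    + 1 / ε * (∫ v, partialX (partialX (h t)) x v * (v * partialX (h t) x v))
    + a * (flux (partialX (h t)) x * flux (partialX (h t)) x
      + flux (h t) x * flux (partialX (partialX (h t))) x)

/-- The hypocoercivity estimate at a fixed position. -/
theorem IsSolution.lyapunovDensityDt_add_le {a c lam Cs ξ : ℝ} (hs : IsSolution ε E K h₀ h)
    (hε : 0 < ε) (hε1 : ε ≤ 1) (hE : ContDiffOn ℝ 3 (E t) (Icc 0 1))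
    (hB : MemLp B 2 volume) (hd : DominatedAt h B t) (ht : 0 < t) (hx : x ∈ Ioo (0 : ℝ) 1)
    (ha0 : 0 ≤ a) (hc0 : 0 ≤ c) (hc : c ≤ 1 / 64) (hlam : lam ≤ 1 / 4)
    (hCs0 : 0 ≤ Cs) (hCs : Cs ≤ 1) (ha : 4 * a ≤ lam - 2 * c)
    (hξ1 : ξ ≤ (lam - 2 * c - 4 * a) / ε ^ 2)
    (hξ2 : ξ ≤ (a * (3 * Cs - 4 * c) - 8 * c) / 8)
    (hE0 : |E t x| ≤ c) (hE1 : |dx (E t) x| ≤ c) :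
    lyapunovDensityDt ε a h t x
      + ξ * ((∫ v, h t x v * h t x v) + ∫ v, partialX (h t) x v * partialX (h t) x v)
      ≤ -boundaryFluxDx ε a h t x
        + a * Cs / 2 * (density (h t) x ^ 2 - density (partialX (h t)) x ^ 2) := by
  have hh := hs.regular
  have hx' := Ioo_subset_Icc_self hx
  have hf := hd.isTest_val hh hB ht hx'
  have hg := hd.isTest_dx hh hB ht hx'
  -- The four balances: energy of h, energy of ∂ₓh, momentum, and the x-derivative of mass.
  have eA := hs.weak_equation hε hB hd ht hx hf
  have eB := hs.weak_equation_dx hε hE hB hd ht hx hg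
  have eC := hs.weak_equation hε hB hd ht hx isTest_mul_sqrtM
  have eD := hs.weak_equation_dx hε hE hB hd ht hx isTest_sqrtM
  simp only [annih_sqrtM, mul_zero, integral_zero, add_zero] at eD
  simp only [annih_mul_sqrtM] at eC
  rw [integral_mul_mul_mul_sqrtM hg.memLp] at eC
  simp_rw [mul_comm (annih (h t x) _ _) (sqrtM _)] at eC
  rw [hf.integral_sqrtM_mul_annih] at eC
  have hA₁ := hf.abs_integral_mul_annih_sub_le hf.memLp
  have hA₂ := hg.abs_integral_mul_annih_sub_le hg.memLp
  have hA₃ := hg.abs_integral_mul_annih_sub_le hf.memLp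
  have hDh := hf.fluctuation_le
  have hDg := hg.fluctuation_le
  have hu := sq_flux_le hf.memLp
  have hux := sq_flux_le hg.memLp
  have hP := sq_second_moment_le hg.memLp
  have hδ : 1 ≤ 1 / ε := (one_le_div hε).2 hε1
  have hεδ : ε * (1 / ε) = 1 := by field_simp
  have hξ1' : ξ ≤ (1 / ε) ^ 2 * (lam - 2 * c - 4 * a) := hξ1.trans_eq (by field_simp)
  have hW := (sq_nonneg _).trans hu
  have hZ := (sq_nonneg _).trans hux
  have key := hypocoercive_inequality (σ := ∫ v, h t x v * sqrtM v)
    (σx := ∫ v, partialX (h t) x v * sqrtM v) hδ ha0 hc0 hc hlam hCs0 hCs ha hξ1' hξ2 hW hZ hDh hDg hu hux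
    hP hA₁ hA₂ hA₃ hE0 hE1
  simp only [← sq] at eA eB
  simp only [lyapunovDensityDt, boundaryFluxDx, ← sq]
  simp only [flux, density]
  simp only [show ∀ v, √(maxwellian v) = sqrtM v from fun _ => rfl]
  generalize 1 / ε = δ at *
  -- The energy balances are scaled by δ = 1/ε because they contain ε times the time derivative, and
  -- `hεδ` removes the product. The multipliers aσₓ and au reproduce the derivative of εa u σₓ.
  linear_combination key + δ * eA + δ * eB + a * (∫ v, partialX (h t) x v * sqrtM v) * eC
    + a * (∫ v, h t x v * (v * sqrtM v)) * eD
    - ((∫ v, partialT h t x v * h t x v)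
      + ∫ v, partialX (partialT h t) x v * partialX (h t) x v) * hεδ

end Hypocoercivity

/-! ### Integrals over velocity as functions of position, and Fubini on the phase space. -/

section Slices

/-- Functions on the phase space that are continuous in each variable and dominated by `B(v)`. -/
structure IsSlice (B : ℝ → ℝ) (F : ℝ → ℝ → ℝ) : Prop where
  continuous : ∀ x ∈ Icc (0 : ℝ) 1, Continuous (F x)
  continuousOn : ∀ v, ContinuousOn (fun x => F x v) (Icc 0 1)
  bound : ∀ x ∈ Icc (0 : ℝ) 1, ∀ v, |F x v| ≤ B v

variable {B C ψ : ℝ → ℝ} {F F' G : ℝ → ℝ → ℝ} {x : ℝ}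

theorem isSlice_const (hψ : Continuous ψ) : IsSlice (fun v => |ψ v|) fun _ => ψ where
  continuous _ _ := hψ
  continuousOn _ := continuousOn_const
  bound _ _ _ := le_rfl

namespace IsSlice

theorem memLp (hB : MemLp B 2 volume) (hF : IsSlice B F) (hx : x ∈ Icc (0 : ℝ) 1) :
    MemLp (F x) 2 volume :=
  memLp_of_bound hB (hF.continuous x hx).aestronglyMeasurable (hF.bound x hx)

theorem continuousOn_integral (hB : MemLp B 2 volume) (hC : MemLp C 2 volume) (hF : IsSlice B F)
    (hG : IsSlice C G) : ContinuousOn (fun x => ∫ v, F x v * G x v) (Icc 0 1) :=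
  continuousOn_integral_mul hB hC (fun x hx => (hF.continuous x hx).aestronglyMeasurable)
    (fun x hx => (hG.continuous x hx).aestronglyMeasurable) hF.continuousOn hG.continuousOn
    hF.bound hG.bound

theorem abs_integral_le (hB : MemLp B 2 volume) (hC : MemLp C 2 volume) (hF : IsSlice B F)
    (hG : IsSlice C G) (hx : x ∈ Icc (0 : ℝ) 1) : |∫ v, F x v * G x v| ≤ ∫ v, B v * C v := by
  rw [← Real.norm_eq_abs]
  refine norm_integral_le_of_norm_le (hB.integrable_mul_two hC) (Eventually.of_forall fun v => ?_)
  rw [norm_mul]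
  exact mul_le_mul (hF.bound x hx v) (hG.bound x hx v) (abs_nonneg _)
    ((abs_nonneg _).trans (hF.bound x hx v))

theorem continuousOn_density (hB : MemLp B 2 volume) (hF : IsSlice B F) :
    ContinuousOn (density F) (Icc 0 1) :=
  continuousOn_integral hB memLp_sqrtM.abs hF (isSlice_const continuous_sqrtM)

theorem continuousOn_flux (hB : MemLp B 2 volume) (hF : IsSlice B F) :
    ContinuousOn (flux F) (Icc 0 1) :=
  continuousOn_integral hB memLp_mul_sqrtM.abs hF
    (isSlice_const (continuous_id.mul continuous_sqrtM))

theorem abs_density_le (hB : MemLp B 2 volume) (hF : IsSlice B F) (hx : x ∈ Icc (0 : ℝ) 1) :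
    |density F x| ≤ ∫ v, B v * |sqrtM v| :=
  abs_integral_le hB memLp_sqrtM.abs hF (isSlice_const continuous_sqrtM) hx

theorem abs_flux_le (hB : MemLp B 2 volume) (hF : IsSlice B F) (hx : x ∈ Icc (0 : ℝ) 1) :
    |flux F x| ≤ ∫ v, B v * |v * sqrtM v| :=
  abs_integral_le hB memLp_mul_sqrtM.abs hF
    (isSlice_const (continuous_id.mul continuous_sqrtM)) hx

theorem hasDerivWithinAt_density (hB : MemLp B 2 volume) (hF : IsSlice B F) (hF' : IsSlice B F')
    (hd : ∀ x ∈ Icc (0 : ℝ) 1, ∀ v, HasDerivWithinAt (fun y => F y v) (F' x v) (Icc 0 1) x)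
    (hx : x ∈ Icc (0 : ℝ) 1) : HasDerivWithinAt (density F) (density F' x) (Icc 0 1) x :=
  hasDerivWithinAt_integral_mul_const (convex_Icc 0 1) hx hB memLp_sqrtM
    (fun _ hy => hF.memLp hB hy) hd hF'.bound

theorem hasDerivWithinAt_flux (hB : MemLp B 2 volume) (hF : IsSlice B F) (hF' : IsSlice B F')
    (hd : ∀ x ∈ Icc (0 : ℝ) 1, ∀ v, HasDerivWithinAt (fun y => F y v) (F' x v) (Icc 0 1) x)
    (hx : x ∈ Icc (0 : ℝ) 1) : HasDerivWithinAt (flux F) (flux F' x) (Icc 0 1) x :=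
  hasDerivWithinAt_integral_mul_const (convex_Icc 0 1) hx hB memLp_mul_sqrtM
    (fun _ hy => hF.memLp hB hy) hd hF'.bound

/-- Integration of the transport term gives the boundary flux. -/
theorem integral_transport (hB : MemLp B 2 volume) (hF : IsSlice B F)
    (hvF : IsSlice B fun x v => v * F x v) (hF' : IsSlice B F')
    (hd : ∀ x ∈ Icc (0 : ℝ) 1, ∀ v, HasDerivWithinAt (fun y => F y v) (F' x v) (Icc 0 1) x) :
    ∫ x in (0 : ℝ)..1, ∫ v, F' x v * (v * F x v) = ∫ v, v / 2 * (F 1 v ^ 2 - F 0 v ^ 2) := by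
  have hi : ∀ x ∈ Icc (0 : ℝ) 1, Integrable fun v => v / 2 * F x v ^ 2 := fun x hx => by
    refine (((hvF.memLp hB hx).integrable_mul_two (hF.memLp hB hx)).const_mul (1 / 2)).congr
      (Eventually.of_forall fun v => ?_)
    simp only
    ring
  have hder : ∀ x ∈ Icc (0 : ℝ) 1, HasDerivWithinAt (fun x => ∫ v, v / 2 * F x v ^ 2)
      (∫ v, F' x v * (v * F x v)) (Icc 0 1) x := by
    intro x hx
    refine hasDerivWithinAt_integral_of_dominated (F' := fun x v => F' x v * (v * F x v))
      (b := fun v => B v * B v) (convex_Icc 0 1) hx hi ?_ ?_ (hB.integrable_mul_two hB)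
    · refine Eventually.of_forall fun v y hy => ?_
      refine (((hd y hy v).pow 2).const_mul (v / 2)).congr_deriv ?_
      simp
      ring
    · refine Eventually.of_forall fun v y hy => ?_
      rw [abs_mul]
      exact mul_le_mul (hF'.bound y hy v) (hvF.bound y hy v) (abs_nonneg _)
        ((abs_nonneg _).trans (hF.bound y hy v))
  rw [intervalIntegral.integral_eq_sub_of_hasDerivAt_of_le zero_le_one
    (fun x hx => (hder x hx).continuousWithinAt)
    (fun x hx => (hder x (Ioo_subset_Icc_self hx)).hasDerivAt (Icc_mem_nhds hx.1 hx.2))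
    ((continuousOn_integral hB hB hF' hvF).intervalIntegrable_of_Icc zero_le_one),
    ← integral_sub (hi 1 (right_mem_Icc.2 zero_le_one)) (hi 0 (left_mem_Icc.2 zero_le_one))]
  congr 1
  ext v
  ring

end IsSlice

theorem volume_restrict_phaseSpace :
    (volume : Measure (ℝ × ℝ)).restrict phaseSpace
      = ((volume : Measure ℝ).restrict (Icc 0 1)).prod volume := by
  rw [phaseSpace, Measure.volume_eq_prod, ← Measure.prod_restrict, Measure.restrict_univ]

theorem measurableSet_phaseSpace : MeasurableSet phaseSpace :=
  measurableSet_Icc.prod MeasurableSet.univ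

theorem memLp_phaseSpace_velocity (hB : MemLp B 2 volume) :
    MemLp (fun p : ℝ × ℝ => B p.2) 2 (volume.restrict phaseSpace) := by
  rw [volume_restrict_phaseSpace]
  exact hB.comp_snd _

theorem integral_phaseSpace {f : ℝ × ℝ → ℝ} (hf : IntegrableOn f phaseSpace) :
    ∫ p in phaseSpace, f p = ∫ x in (0 : ℝ)..1, ∫ v, f (x, v) := by
  rw [phaseSpace, Measure.volume_eq_prod, setIntegral_prod _ hf,
    intervalIntegral.integral_of_le zero_le_one, integral_Icc_eq_integral_Ioc]
  simp

theorem memLp_phaseSpace (hB : MemLp B 2 volume)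
    (hF : ContinuousOn (Function.uncurry F) phaseSpace)
    (hb : ∀ x ∈ Icc (0 : ℝ) 1, ∀ v, |F x v| ≤ B v) :
    MemLp (Function.uncurry F) 2 (volume.restrict phaseSpace) := by
  refine (memLp_phaseSpace_velocity hB).mono' (hF.aestronglyMeasurable measurableSet_phaseSpace) ?_
  filter_upwards [ae_restrict_mem measurableSet_phaseSpace] with p hp
  exact hb p.1 hp.1 p.2

end Slices

/-! ### The Lyapunov functional and the boundary terms as integrals over position. -/

section Solution

variable {h : ℝ → ℝ → ℝ → ℝ} {B : ℝ → ℝ} {t x : ℝ}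

namespace DominatedAt

variable (hh : IsRegular h) (hd : DominatedAt h B t) (ht : 0 < t)

include hh hd ht

theorem slice_val : IsSlice B (h t) :=
  ⟨fun _ hx => hh.continuous_val ht hx, continuousOn_space_slice hh.continuousOn ht, hd.val⟩

theorem slice_mul_val : IsSlice B fun x v => v * h t x v :=
  ⟨fun _ hx => continuous_id.mul (hh.continuous_val ht hx),
    fun v => continuousOn_const.mul (continuousOn_space_slice hh.continuousOn ht v), hd.mul_val⟩

theorem slice_dx : IsSlice B (partialX (h t)) :=
  ⟨fun _ hx => hh.continuous_dx ht hx, continuousOn_space_slice hh.continuousOn_partialX ht, hd.dx⟩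

theorem slice_mul_dx : IsSlice B fun x v => v * partialX (h t) x v :=
  ⟨fun _ hx => continuous_id.mul (hh.continuous_dx ht hx),
    fun v => continuousOn_const.mul (continuousOn_space_slice hh.continuousOn_partialX ht v),
    hd.mul_dx⟩

theorem slice_dt : IsSlice B (partialT h t) :=
  ⟨fun _ hx => hh.continuous_dt ht hx, continuousOn_space_slice hh.continuousOn_partialT ht, hd.dt⟩

theorem slice_dxx : IsSlice B (partialX (partialX (h t))) :=
  ⟨fun _ hx => hh.continuous_dxx ht hx, continuousOn_space_slice hh.continuousOn_partialXX ht,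
    hd.dxx⟩

theorem slice_dxt : IsSlice B (partialX (partialT h t)) :=
  ⟨fun _ hx => hh.continuous_dxt ht hx, continuousOn_space_slice hh.continuousOn_partialXT ht,
    hd.dxt⟩

variable (hB : MemLp B 2 volume)

include hB

theorem hasDerivWithinAt_density (hx : x ∈ Icc (0 : ℝ) 1) :
    HasDerivWithinAt (density (h t)) (density (partialX (h t)) x) (Icc 0 1) x :=
  IsSlice.hasDerivWithinAt_density hB (hd.slice_val hh ht) (hd.slice_dx hh ht)
    (fun _ hy v => hh.hasDerivWithinAt_space ht hy v) hx

theorem hasDerivWithinAt_flux (hx : x ∈ Icc (0 : ℝ) 1) :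
    HasDerivWithinAt (flux (h t)) (flux (partialX (h t)) x) (Icc 0 1) x :=
  IsSlice.hasDerivWithinAt_flux hB (hd.slice_val hh ht) (hd.slice_dx hh ht)
    (fun _ hy v => hh.hasDerivWithinAt_space ht hy v) hx

theorem hasDerivWithinAt_flux_dx (hx : x ∈ Icc (0 : ℝ) 1) :
    HasDerivWithinAt (flux (partialX (h t))) (flux (partialX (partialX (h t))) x) (Icc 0 1) x :=
  IsSlice.hasDerivWithinAt_flux hB (hd.slice_dx hh ht) (hd.slice_dxx hh ht)
    (fun _ hy v => hh.hasDerivWithinAt_partialX ht hy v) hx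

theorem dx_density_eq (hx : x ∈ Icc (0 : ℝ) 1) :
    VFP.dx (density (h t)) x = density (partialX (h t)) x :=
  (hd.hasDerivWithinAt_density hh ht hB hx).derivWithin (uniqueDiffOn_Icc zero_lt_one x hx)

theorem dx_flux_eq (hx : x ∈ Icc (0 : ℝ) 1) :
    VFP.dx (flux (h t)) x = flux (partialX (h t)) x :=
  (hd.hasDerivWithinAt_flux hh ht hB hx).derivWithin (uniqueDiffOn_Icc zero_lt_one x hx)

theorem integral_flux_dx :
    ∫ x in (0 : ℝ)..1, flux (partialX (h t)) x = flux (h t) 1 - flux (h t) 0 :=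
  intervalIntegral.integral_eq_sub_of_hasDerivAt_of_le zero_le_one
    ((hd.slice_val hh ht).continuousOn_flux hB)
    (fun _ hx => (hd.hasDerivWithinAt_flux hh ht hB (Ioo_subset_Icc_self hx)).hasDerivAt
      (Icc_mem_nhds hx.1 hx.2))
    (((hd.slice_dx hh ht).continuousOn_flux hB).intervalIntegrable_of_Icc zero_le_one)

theorem memLp_phaseSpace_val : MemLp (Function.uncurry (h t)) 2 (volume.restrict phaseSpace) :=
  memLp_phaseSpace hB (continuousOn_phase_slice hh.continuousOn ht) hd.val

theorem memLp_phaseSpace_dx :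
    MemLp (Function.uncurry (partialX (h t))) 2 (volume.restrict phaseSpace) :=
  memLp_phaseSpace hB (continuousOn_phase_slice hh.continuousOn_partialX ht) hd.dx

theorem integral_phaseSpace_dx_sq :
    ∫ p in phaseSpace, partialX (h t) p.1 p.2 ^ 2
      = ∫ x in (0 : ℝ)..1, ∫ v, partialX (h t) x v * partialX (h t) x v := by
  have i := (hd.memLp_phaseSpace_dx hh ht hB).integrable_sq
  simp_rw [← sq]
  exact integral_phaseSpace i

theorem normVSq_eq :
    normVSq (h t) = ∫ x in (0 : ℝ)..1, ((∫ v, h t x v * h t x v)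
      + ∫ v, partialX (h t) x v * partialX (h t) x v) := by
  have i := (hd.memLp_phaseSpace_val hh ht hB).integrable_sq
  have e : ∫ p in phaseSpace, h t p.1 p.2 ^ 2 = ∫ x in (0 : ℝ)..1, ∫ v, h t x v * h t x v := by
    simp_rw [← sq]
    exact integral_phaseSpace i
  have s1 := hd.slice_val hh ht
  have s2 := hd.slice_dx hh ht
  rw [normVSq, e, hd.integral_phaseSpace_dx_sq hh ht hB, intervalIntegral.integral_add
    ((s1.continuousOn_integral hB hB s1).intervalIntegrable_of_Icc zero_le_one)
    ((s2.continuousOn_integral hB hB s2).intervalIntegrable_of_Icc zero_le_one)]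

theorem lyapunov_eq (ε a : ℝ) :
    lyapunov ε a h t = ∫ x in (0 : ℝ)..1, lyapunovDensity ε a h t x := by
  have s1 := hd.slice_val hh ht
  have s2 := hd.slice_dx hh ht
  have e : ∫ x in (0 : ℝ)..1, flux (h t) x * VFP.dx (density (h t)) x
      = ∫ x in (0 : ℝ)..1, flux (h t) x * density (partialX (h t)) x := by
    refine intervalIntegral.integral_congr fun x hx => ?_
    rw [uIcc_of_le zero_le_one] at hx
    rw [hd.dx_density_eq hh ht hB hx]
  have c1 : ContinuousOn (fun x => 1 / 2 * ((∫ v, h t x v * h t x v)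
      + ∫ v, partialX (h t) x v * partialX (h t) x v)) (Icc 0 1) :=
    continuousOn_const.mul
      ((s1.continuousOn_integral hB hB s1).add (s2.continuousOn_integral hB hB s2))
  have c2 : ContinuousOn (fun x => ε * a * (flux (h t) x * density (partialX (h t)) x))
      (Icc 0 1) :=
    continuousOn_const.mul ((s1.continuousOn_flux hB).mul (s2.continuousOn_density hB))
  simp only [lyapunovDensity]
  rw [intervalIntegral.integral_add (c1.intervalIntegrable_of_Icc zero_le_one)
    (c2.intervalIntegrable_of_Icc zero_le_one), intervalIntegral.integral_const_mul,
    intervalIntegral.integral_const_mul, lyapunov, hd.normVSq_eq hh ht hB, e]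

theorem continuousOn_lyapunovDensity (ε a : ℝ) :
    ContinuousOn (lyapunovDensity ε a h t) (Icc 0 1) := by
  have s1 := hd.slice_val hh ht
  have s2 := hd.slice_dx hh ht
  exact (continuousOn_const.mul
    ((s1.continuousOn_integral hB hB s1).add (s2.continuousOn_integral hB hB s2))).add
    (continuousOn_const.mul ((s1.continuousOn_flux hB).mul (s2.continuousOn_density hB)))

theorem continuousOn_boundaryFluxDx (ε a : ℝ) :
    ContinuousOn (boundaryFluxDx ε a h t) (Icc 0 1) := by
  have s2 := hd.slice_dx hh ht
  have s3 := hd.slice_dxx hh ht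
  exact ((continuousOn_const.mul
    (s2.continuousOn_integral hB hB (hd.slice_mul_val hh ht))).add (continuousOn_const.mul
    (s3.continuousOn_integral hB hB (hd.slice_mul_dx hh ht)))).add (continuousOn_const.mul
    (((s2.continuousOn_flux hB).mul (s2.continuousOn_flux hB)).add
      (((hd.slice_val hh ht).continuousOn_flux hB).mul (s3.continuousOn_flux hB))))

theorem continuousOn_lyapunovDensityDt (ε a : ℝ) :
    ContinuousOn (lyapunovDensityDt ε a h t) (Icc 0 1) := by
  have s1 := hd.slice_val hh ht
  have s2 := hd.slice_dx hh ht
  have s3 := hd.slice_dt hh ht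
  have s4 := hd.slice_dxt hh ht
  exact ((s3.continuousOn_integral hB hB s1).add (s4.continuousOn_integral hB hB s2)).add
    (continuousOn_const.mul
      (((s3.continuousOn_flux hB).mul (s2.continuousOn_density hB)).add
        ((s1.continuousOn_flux hB).mul (s4.continuousOn_density hB))))

theorem integral_boundaryFluxDx (ε a : ℝ) :
    ∫ x in (0 : ℝ)..1, boundaryFluxDx ε a h t x
      = 1 / ε * (∫ v, v / 2 * (h t 1 v ^ 2 - h t 0 v ^ 2))
        + 1 / ε * (∫ v, v / 2 * (partialX (h t) 1 v ^ 2 - partialX (h t) 0 v ^ 2))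
        + a * (flux (h t) 1 * VFP.dx (flux (h t)) 1 - flux (h t) 0 * VFP.dx (flux (h t)) 0) := by
  have s1 := hd.slice_val hh ht
  have s2 := hd.slice_dx hh ht
  have s3 := hd.slice_dxx hh ht
  have c1 := (s2.continuousOn_integral hB hB (hd.slice_mul_val hh ht)).intervalIntegrable_of_Icc
    zero_le_one (μ := volume)
  have c2 := (s3.continuousOn_integral hB hB (hd.slice_mul_dx hh ht)).intervalIntegrable_of_Icc
    zero_le_one (μ := volume)
  have c3 : IntervalIntegrable (fun x => flux (partialX (h t)) x * flux (partialX (h t)) x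
      + flux (h t) x * flux (partialX (partialX (h t))) x) volume 0 1 := (((s2.continuousOn_flux hB).mul (s2.continuousOn_flux hB)).add
    ((s1.continuousOn_flux hB).mul (s3.continuousOn_flux hB))).intervalIntegrable_of_Icc
    zero_le_one
  have e1 := IsSlice.integral_transport hB s1 (hd.slice_mul_val hh ht) s2
    (fun x hx v => hh.hasDerivWithinAt_space ht hx v)
  have e2 := IsSlice.integral_transport hB s2 (hd.slice_mul_dx hh ht) s3
    (fun x hx v => hh.hasDerivWithinAt_partialX ht hx v)
  have e3 : ∫ x in (0 : ℝ)..1, (flux (partialX (h t)) x * flux (partialX (h t)) x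
      + flux (h t) x * flux (partialX (partialX (h t))) x)
      = flux (h t) 1 * flux (partialX (h t)) 1 - flux (h t) 0 * flux (partialX (h t)) 0 :=
    intervalIntegral.integral_eq_sub_of_hasDerivAt_of_le
      (f := fun x => flux (h t) x * flux (partialX (h t)) x) zero_le_one
      ((s1.continuousOn_flux hB).mul (s2.continuousOn_flux hB))
      (fun x hx => ((hd.hasDerivWithinAt_flux hh ht hB (Ioo_subset_Icc_self hx)).mul
        (hd.hasDerivWithinAt_flux_dx hh ht hB (Ioo_subset_Icc_self hx))).hasDerivAt
        (Icc_mem_nhds hx.1 hx.2)) c3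
  rw [← e1, ← e2, hd.dx_flux_eq hh ht hB (right_mem_Icc.2 zero_le_one),
    hd.dx_flux_eq hh ht hB (left_mem_Icc.2 zero_le_one), ← e3]
  simp only [boundaryFluxDx]
  rw [intervalIntegral.integral_add ((c1.const_mul _).add (c2.const_mul _)) (c3.const_mul _),
    intervalIntegral.integral_add (c1.const_mul _) (c2.const_mul _),
    intervalIntegral.integral_const_mul, intervalIntegral.integral_const_mul,
    intervalIntegral.integral_const_mul]

end DominatedAt

end Solution

/-! ### Differentiability in time of the Lyapunov functional and of the mass. -/

section TimeDerivative

variable {h : ℝ → ℝ → ℝ → ℝ} {B : ℝ → ℝ} {t x τ T : ℝ}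

/-- On the unit interval a constant dominates, so bounds on the velocity integrals that are uniform
in x and locally uniform in t suffice. -/
theorem hasDerivAt_integral_unit {F F' : ℝ → ℝ → ℝ} {C : ℝ} (hI : Icc τ T ∈ 𝓝 t)
    (hF : ∀ s ∈ Icc τ T, ContinuousOn (F s) (Icc 0 1))
    (hd : ∀ x ∈ Icc (0 : ℝ) 1, ∀ s ∈ Icc τ T,
      HasDerivWithinAt (fun r => F r x) (F' s x) (Icc τ T) s)
    (hC : ∀ x ∈ Icc (0 : ℝ) 1, ∀ s ∈ Icc τ T, |F' s x| ≤ C) :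
    HasDerivAt (fun s => ∫ x in (0 : ℝ)..1, F s x) (∫ x in (0 : ℝ)..1, F' t x) t := by
  have hae : ∀ᵐ x ∂(volume.restrict (Ioc (0 : ℝ) 1)), x ∈ Icc (0 : ℝ) 1 := by
    filter_upwards [ae_restrict_mem measurableSet_Ioc] with x hx
    exact Ioc_subset_Icc_self hx
  simp only [intervalIntegral.integral_of_le (zero_le_one' ℝ)]
  refine HasDerivWithinAt.hasDerivAt ?_ hI
  refine hasDerivWithinAt_integral_of_dominated (b := fun _ => C) (convex_Icc τ T)
    (mem_of_mem_nhds hI) ?_ ?_ ?_ (integrable_const _)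
  · exact fun s hs => ((hF s hs).integrableOn_Icc).mono_set Ioc_subset_Icc_self
  · filter_upwards [hae] with x hx
    exact hd x hx
  · filter_upwards [hae] with x hx
    exact hC x hx

theorem hasDerivWithinAt_integral_mul_self (hB : MemLp B 2 volume) {I : Set ℝ} (hI : Convex ℝ I) (ht : t ∈ I) {F F' : ℝ → ℝ → ℝ}
    (hFm : ∀ s ∈ I, AEStronglyMeasurable (F s) volume)
    (hF : ∀ s ∈ I, ∀ v, HasDerivWithinAt (fun r => F r v) (F' s v) I s)
    (hFB : ∀ s ∈ I, ∀ v, |F s v| ≤ B v) (hFB' : ∀ s ∈ I, ∀ v, |F' s v| ≤ B v) :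
    HasDerivWithinAt (fun s => ∫ v, F s v * F s v) (2 * ∫ v, F' t v * F t v) I t := by
  refine (hasDerivWithinAt_integral_mul hI ht hB hB hFm hFm hF hF hFB hFB' hFB hFB').congr_deriv ?_
  rw [← integral_const_mul]
  congr 1
  ext v
  ring

namespace IsRegular

variable (hh : IsRegular h) (hB : MemLp B 2 volume) (hτ : 0 < τ)
  (hd : ∀ s ∈ Icc τ T, DominatedAt h B s)

include hh hB hτ hd

theorem hasDerivWithinAt_time_density (ht : t ∈ Icc τ T) (hx : x ∈ Icc (0 : ℝ) 1) :
    HasDerivWithinAt (fun s => density (h s) x) (density (partialT h t) x) (Icc τ T) t :=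
  hasDerivWithinAt_integral_mul_const (F := fun s v => h s x v)
    (F' := fun s v => partialT h s x v) (convex_Icc τ T) ht hB memLp_sqrtM
    (fun s hs => (hd s hs).memLp_val hh hB (hτ.trans_le hs.1) hx)
    (fun _ hs v => (hh.hasDerivAt_time (hτ.trans_le hs.1) hx v).hasDerivWithinAt)
    (fun s hs => (hd s hs).dt x hx)

theorem hasDerivWithinAt_time_flux (ht : t ∈ Icc τ T) (hx : x ∈ Icc (0 : ℝ) 1) :
    HasDerivWithinAt (fun s => flux (h s) x) (flux (partialT h t) x) (Icc τ T) t :=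
  hasDerivWithinAt_integral_mul_const (F := fun s v => h s x v)
    (F' := fun s v => partialT h s x v) (convex_Icc τ T) ht hB memLp_mul_sqrtM
    (fun s hs => (hd s hs).memLp_val hh hB (hτ.trans_le hs.1) hx)
    (fun _ hs v => (hh.hasDerivAt_time (hτ.trans_le hs.1) hx v).hasDerivWithinAt)
    (fun s hs => (hd s hs).dt x hx)

theorem hasDerivWithinAt_time_density_dx (ht : t ∈ Icc τ T) (hx : x ∈ Icc (0 : ℝ) 1) :
    HasDerivWithinAt (fun s => density (partialX (h s)) x) (density (partialX (partialT h t)) x)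
      (Icc τ T) t :=
  hasDerivWithinAt_integral_mul_const (F := fun s v => partialX (h s) x v)
    (F' := fun s v => partialX (partialT h s) x v) (convex_Icc τ T) ht hB memLp_sqrtM
    (fun s hs => (hd s hs).memLp_dx hh hB (hτ.trans_le hs.1) hx)
    (fun _ hs v => (hh.hasDerivAt_time_partialX (hτ.trans_le hs.1) hx v).hasDerivWithinAt)
    (fun s hs => (hd s hs).dxt x hx)

theorem hasDerivWithinAt_lyapunovDensity (ε a : ℝ) (ht : t ∈ Icc τ T) (hx : x ∈ Icc (0 : ℝ) 1) :
    HasDerivWithinAt (fun s => lyapunovDensity ε a h s x) (lyapunovDensityDt ε a h t x)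
      (Icc τ T) t := by
  have d1 := hasDerivWithinAt_integral_mul_self hB (convex_Icc τ T) ht (F := fun s v => h s x v)
    (F' := fun s v => partialT h s x v)
    (fun s hs => (hh.continuous_val (hτ.trans_le hs.1) hx).aestronglyMeasurable)
    (fun _ hs v => (hh.hasDerivAt_time (hτ.trans_le hs.1) hx v).hasDerivWithinAt)
    (fun s hs => (hd s hs).val x hx) (fun s hs => (hd s hs).dt x hx)
  have d2 := hasDerivWithinAt_integral_mul_self hB (convex_Icc τ T) ht
    (F := fun s v => partialX (h s) x v) (F' := fun s v => partialX (partialT h s) x v)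
    (fun s hs => (hh.continuous_dx (hτ.trans_le hs.1) hx).aestronglyMeasurable)
    (fun _ hs v => (hh.hasDerivAt_time_partialX (hτ.trans_le hs.1) hx v).hasDerivWithinAt)
    (fun s hs => (hd s hs).dx x hx) (fun s hs => (hd s hs).dxt x hx)
  have d3 := (hh.hasDerivWithinAt_time_flux hB hτ hd ht hx).mul
    (hh.hasDerivWithinAt_time_density_dx hB hτ hd ht hx)
  refine (((d1.add d2).const_mul (1 / 2)).add (d3.const_mul (ε * a))).congr_deriv ?_
  simp only [lyapunovDensityDt]
  ring

theorem hasDerivAt_lyapunov (ε a : ℝ) (ht : Icc τ T ∈ 𝓝 t) :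
    HasDerivAt (lyapunov ε a h) (∫ x in (0 : ℝ)..1, lyapunovDensityDt ε a h t x) t := by
  have hpos : ∀ s ∈ Icc τ T, 0 < s := fun s hs => hτ.trans_le hs.1
  have hmain : HasDerivAt (fun s => ∫ x in (0 : ℝ)..1, lyapunovDensity ε a h s x)
      (∫ x in (0 : ℝ)..1, lyapunovDensityDt ε a h t x) t := by
    refine hasDerivAt_integral_unit
      (C := (∫ v, B v * B v) + (∫ v, B v * B v) + |ε * a| *
        ((∫ v, B v * |v * sqrtM v|) * (∫ v, B v * |sqrtM v|)
          + (∫ v, B v * |v * sqrtM v|) * (∫ v, B v * |sqrtM v|))) ht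
      (fun s hs => (hd s hs).continuousOn_lyapunovDensity hh (hpos s hs) hB ε a)
      (fun x hx s hs => hh.hasDerivWithinAt_lyapunovDensity hB hτ hd ε a hs hx) ?_
    intro x hx s hs
    have s1 := (hd s hs).slice_val hh (hpos s hs)
    have s2 := (hd s hs).slice_dx hh (hpos s hs)
    have s3 := (hd s hs).slice_dt hh (hpos s hs)
    have s4 := (hd s hs).slice_dxt hh (hpos s hs)
    have b1 := s1.abs_flux_le hB hx
    have b2 := s2.abs_density_le hB hx
    have b3 := s3.abs_flux_le hB hx
    have b4 := s4.abs_density_le hB hx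
    have n1 := (abs_nonneg _).trans b1
    refine (abs_add_le _ _).trans (add_le_add ((abs_add_le _ _).trans (add_le_add
      (s3.abs_integral_le hB hB s1 hx) (s4.abs_integral_le hB hB s2 hx))) ?_)
    rw [abs_mul]
    refine mul_le_mul_of_nonneg_left ((abs_add_le _ _).trans (add_le_add ?_ ?_)) (abs_nonneg _)
    · rw [abs_mul]
      exact mul_le_mul b3 b2 (abs_nonneg _) n1
    · rw [abs_mul]
      exact mul_le_mul b1 b4 (abs_nonneg _) n1
  refine hmain.congr_of_eventuallyEq ?_
  filter_upwards [ht] with s hs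
  exact (hd s hs).lyapunov_eq hh (hpos s hs) hB ε a

theorem hasDerivAt_mass (ht : Icc τ T ∈ 𝓝 t) :
    HasDerivAt (fun s => ∫ x in (0 : ℝ)..1, density (h s) x)
      (∫ x in (0 : ℝ)..1, density (partialT h t) x) t := by
  have hpos : ∀ s ∈ Icc τ T, 0 < s := fun s hs => hτ.trans_le hs.1
  exact hasDerivAt_integral_unit ht
    (fun s hs => ((hd s hs).slice_val hh (hpos s hs)).continuousOn_density hB)
    (fun x hx s hs => hh.hasDerivWithinAt_time_density hB hτ hd hs hx)
    (fun x hx s hs => ((hd s hs).slice_dt hh (hpos s hs)).abs_density_le hB hx)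

end IsRegular

/-- Around every positive time the solution is dominated. -/
theorem IsRegular.exists_dominatedAt_nhds (hh : IsRegular h) (ht : 0 < t) :
    ∃ B : ℝ → ℝ, MemLp B 2 volume ∧ 0 < t / 2 ∧ Icc (t / 2) (2 * t) ∈ 𝓝 t ∧
      ∀ s ∈ Icc (t / 2) (2 * t), DominatedAt h B s := by
  obtain ⟨B, hB, hd⟩ := hh.exists_dominatedAt (2 * t) (half_pos ht)
  exact ⟨B, hB, half_pos ht, Icc_mem_nhds (by linarith) (by linarith), hd⟩

end TimeDerivative

/-! ### The mass balance from the initial time on. -/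

section Mass

variable {h : ℝ → ℝ → ℝ → ℝ} {t ε : ℝ} {E : ℝ → ℝ → ℝ} {K : Matrix (Fin 2) (Fin 2) ℝ}
  {h₀ : ℝ → ℝ → ℝ}

/-- Conservation of mass up to the flux through the boundary. -/
theorem IsSolution.hasDerivAt_mass (hs : IsSolution ε E K h₀ h) (hε : 0 < ε) (ht : 0 < t) :
    HasDerivAt (fun s => ∫ x in (0 : ℝ)..1, density (h s) x)
      (-(1 / ε) * (flux (h t) 1 - flux (h t) 0)) t := by
  have hh := hs.regular
  obtain ⟨B, hB, hτ, hI, hd⟩ := hh.exists_dominatedAt_nhds ht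
  have hdt := hd t (mem_of_mem_nhds hI)
  refine (hh.hasDerivAt_mass hB hτ hd hI).congr_deriv ?_
  rw [← hdt.integral_flux_dx hh ht hB, ← intervalIntegral.integral_const_mul]
  refine intervalIntegral.integral_congr_Ioo_of_le zero_le_one fun x hx => ?_
  -- Since A√M = 0, neither the collision nor the field term contributes to the mass balance.
  have e := hs.weak_equation hε hB hdt ht hx isTest_sqrtM
  simp only [annih_sqrtM, mul_zero, integral_zero, add_zero] at e
  change ε * density (partialT h t) x + flux (partialX (h t)) x = 0 at e
  have h1 : ε * (1 / ε) = 1 := by field_simp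
  linear_combination (1 / ε) * e - density (partialT h t) x * h1

theorem IsRegular.continuousAt_flux (hh : IsRegular h) (ht : 0 < t) {x : ℝ}
    (hx : x ∈ Icc (0 : ℝ) 1) : ContinuousAt (fun s => flux (h s) x) t := by
  obtain ⟨B, hB, hτ, hI, hd⟩ := hh.exists_dominatedAt_nhds ht
  exact ((hh.hasDerivWithinAt_time_flux hB hτ hd (mem_of_mem_nhds hI) hx).hasDerivAt
    hI).continuousAt

/-- The net flux through the boundary is controlled by `∂ₓh`. -/
theorem IsRegular.abs_flux_sub_le (hh : IsRegular h) (ht : 0 < t) :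
    |flux (h t) 1 - flux (h t) 0| ≤ 1 + ∫ p in phaseSpace, partialX (h t) p.1 p.2 ^ 2 := by
  obtain ⟨B, hB, -, hI, hd⟩ := hh.exists_dominatedAt_nhds ht
  have hdt := hd t (mem_of_mem_nhds hI)
  have s2 := hdt.slice_dx hh ht
  have c2 := s2.continuousOn_integral hB hB s2
  rw [hdt.integral_phaseSpace_dx_sq hh ht hB, ← hdt.integral_flux_dx hh ht hB]
  have h1 : 1 + (∫ x in (0 : ℝ)..1, ∫ v, partialX (h t) x v * partialX (h t) x v)
      = ∫ x in (0 : ℝ)..1, (1 + ∫ v, partialX (h t) x v * partialX (h t) x v) := by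
    rw [intervalIntegral.integral_add intervalIntegrable_const
      (c2.intervalIntegrable_of_Icc zero_le_one)]
    simp
  rw [h1, ← Real.norm_eq_abs]
  refine intervalIntegral.norm_integral_le_of_norm_le zero_le_one
    (Eventually.of_forall fun x hx => ?_)
    ((continuousOn_const.add c2).intervalIntegrable_of_Icc zero_le_one)
  have hm := hdt.memLp_dx hh hB ht (Ioc_subset_Icc_self hx)
  have hf := sq_flux_le hm
  have hsq : flux (partialX (h t)) x ^ 2 ≤ ∫ v, partialX (h t) x v * partialX (h t) x v := by
    simp_rw [← sq]
    -- The constant 1 in the claim comes from |y| ≤ 1 + y², applied below to the flux of ∂ₓh.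
    exact hf.trans (sub_le_self _ (sq_nonneg _))
  rw [Real.norm_eq_abs, abs_le]
  constructor <;> nlinarith [sq_nonneg (flux (partialX (h t)) x + 1 / 2),
    sq_nonneg (flux (partialX (h t)) x - 1 / 2)]

theorem sq_le_two_mul (y z : ℝ) : y ^ 2 ≤ 2 * (y - z) ^ 2 + 2 * z ^ 2 := by
  linarith [sq_nonneg (y - 2 * z), sub_sq y z, sub_sq y (2 * z)]

/-- The domination degenerates as t ↓ 0, so integrability there comes from the initial datum: the
net flux is at most 1 + ‖∂ₓh‖², which stays bounded because h(t) converges in V. Away from 0 the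
flux is continuous. -/
theorem IsSolution.intervalIntegrable_flux (hs : IsSolution ε E K h₀ h) (ht : 0 < t) :
    IntervalIntegrable (fun s => flux (h s) 1 - flux (h s) 0) volume 0 t := by
  have hh := hs.regular
  obtain ⟨w, hw, hlim⟩ := hs.initial
  have hcont : ContinuousOn (fun s => flux (h s) 1 - flux (h s) 0) (Ioi 0) := fun s hs =>
    ((hh.continuousAt_flux hs (right_mem_Icc.2 zero_le_one)).sub
      (hh.continuousAt_flux hs (left_mem_Icc.2 zero_le_one))).continuousWithinAt
  have hev : ∀ᶠ s in 𝓝[>] (0 : ℝ), |flux (h s) 1 - flux (h s) 0|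
      ≤ 3 + 2 * ∫ p in phaseSpace, w p.1 p.2 ^ 2 := by
    filter_upwards [hlim.eventually_lt_const one_pos, self_mem_nhdsWithin] with s h1 hs0
    obtain ⟨B, hB, -, hI, hd⟩ := hh.exists_dominatedAt_nhds hs0
    have hds := hd s (mem_of_mem_nhds hI)
    have m1 := hds.memLp_phaseSpace_dx hh hs0 hB
    have m2 := hw.memLp_dx
    have n1 : 0 ≤ ∫ p in phaseSpace, (h s p.1 p.2 - h₀ p.1 p.2) ^ 2 :=
      integral_nonneg fun _ => sq_nonneg _
    have i1 : Integrable (fun p : ℝ × ℝ => 2 * (partialX (h s) p.1 p.2 - w p.1 p.2) ^ 2)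
      (volume.restrict phaseSpace) := (m1.sub m2).integrable_sq.const_mul 2
    have i2 : Integrable (fun p : ℝ × ℝ => 2 * w p.1 p.2 ^ 2)
      (volume.restrict phaseSpace) := m2.integrable_sq.const_mul 2
    have hle : ∫ p in phaseSpace, partialX (h s) p.1 p.2 ^ 2
        ≤ ∫ p in phaseSpace,
          (2 * (partialX (h s) p.1 p.2 - w p.1 p.2) ^ 2 + 2 * w p.1 p.2 ^ 2) :=
      integral_mono m1.integrable_sq (i1.add i2) fun p => sq_le_two_mul _ _
    rw [integral_add i1 i2, integral_const_mul, integral_const_mul] at hle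
    linarith [hh.abs_flux_sub_le hs0]
  obtain ⟨r, hr, hrb⟩ := mem_nhdsGT_iff_exists_Ioc_subset.1 hev
  set r' := min r t
  have hr' : 0 < r' := lt_min hr ht
  have hr't : r' ≤ t := min_le_right _ _
  rw [intervalIntegrable_iff_integrableOn_Ioc_of_le ht.le, ← Ioc_union_Icc_eq_Ioc hr' hr't]
  refine IntegrableOn.union ?_ ?_
  · have hm : ContinuousOn (fun s => flux (h s) 1 - flux (h s) 0) (Ioc 0 r') :=
      hcont.mono fun s hs => hs.1
    refine Integrable.of_bound (hm.aestronglyMeasurable measurableSet_Ioc)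
      (3 + 2 * ∫ p in phaseSpace, w p.1 p.2 ^ 2) ?_
    filter_upwards [ae_restrict_mem measurableSet_Ioc] with s hs
    exact hrb ⟨hs.1, hs.2.trans (min_le_left _ _)⟩
  · exact (hcont.mono fun s hs => hr'.trans_le hs.1).integrableOn_Icc

/-- The total mass tends to the initial mass. -/
theorem IsSolution.tendsto_mass (hs : IsSolution ε E K h₀ h)
    (hmass : ∫ p in phaseSpace, h₀ p.1 p.2 * sqrtM p.2 = 0) :
    Tendsto (fun s => ∫ x in (0 : ℝ)..1, density (h s) x) (𝓝[>] 0) (𝓝 0) := by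
  have hh := hs.regular
  obtain ⟨w, hw, hlim⟩ := hs.initial
  have hM := memLp_phaseSpace_velocity memLp_sqrtM
  have hbound : Tendsto (fun s => √(((∫ p in phaseSpace, (h s p.1 p.2 - h₀ p.1 p.2) ^ 2)
        + ∫ p in phaseSpace, (partialX (h s) p.1 p.2 - w p.1 p.2) ^ 2)
        * ∫ p in phaseSpace, sqrtM p.2 ^ 2)) (𝓝[>] 0) (𝓝 0) := by
    simpa using (hlim.mul_const (∫ p in phaseSpace, sqrtM p.2 ^ 2)).sqrt
  refine squeeze_zero_norm' ?_ hbound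
  filter_upwards [self_mem_nhdsWithin] with s hs0
  obtain ⟨B, hB, -, hI, hd⟩ := hh.exists_dominatedAt_nhds hs0
  have hds := hd s (mem_of_mem_nhds hI)
  have m1 := hds.memLp_phaseSpace_val hh hs0 hB
  have m0 := hw.memLp
  have i1 : Integrable (fun p : ℝ × ℝ => h s p.1 p.2 * sqrtM p.2)
    (volume.restrict phaseSpace) := m1.integrable_mul_two hM
  have i0 : Integrable (fun p : ℝ × ℝ => h₀ p.1 p.2 * sqrtM p.2)
    (volume.restrict phaseSpace) := m0.integrable_mul_two hM
  have e1 : ∫ x in (0 : ℝ)..1, density (h s) x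
      = ∫ p in phaseSpace, (h s p.1 p.2 - h₀ p.1 p.2) * sqrtM p.2 := by
    simp_rw [sub_mul]
    rw [integral_sub i1 i0, hmass, sub_zero]
    exact (integral_phaseSpace i1).symm
  have hcs := sq_integral_mul_le (m1.sub m0) hM
  rw [e1, Real.norm_eq_abs]
  refine Real.abs_le_sqrt (hcs.trans (mul_le_mul_of_nonneg_right ?_
    (integral_nonneg fun _ => sq_nonneg _)))
  exact le_add_of_nonneg_right (integral_nonneg fun _ => sq_nonneg _)

/-- The fundamental theorem of calculus on (0,t), with the limit 0 of the mass at time 0 in place of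
an initial value. -/
theorem IsSolution.mass_eq (hs : IsSolution ε E K h₀ h) (hε : 0 < ε) (ht : 0 < t)
    (hmass : ∫ p in phaseSpace, h₀ p.1 p.2 * sqrtM p.2 = 0) :
    ∫ x in (0 : ℝ)..1, density (h t) x
      = -(1 / ε) * ∫ s in (0 : ℝ)..t, (flux (h s) 1 - flux (h s) 0) := by
  have hftc := intervalIntegral.integral_eq_sub_of_hasDerivAt_of_tendsto ht
    (fun s h0 => hs.hasDerivAt_mass hε h0.1) ((hs.intervalIntegrable_flux ht).const_mul _)
    (hs.tendsto_mass hmass)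
    ((hs.hasDerivAt_mass hε ht).continuousAt.tendsto.mono_left nhdsWithin_le_nhds)
  rw [intervalIntegral.integral_const_mul, sub_zero] at hftc
  exact hftc.symm

end Mass

end VFP

/-! ### The differential inequality for the Lyapunov functional. -/

theorem mainTheorem3
    (lam C_s C_E ε a : ℝ)
    (hlam : 0 < lam) (hlam' : lam ≤ 1 / 4)
    (hCs : 0 < C_s) (hCs' : C_s ≤ 1)
    (hε : 0 < ε) (hε' : ε ≤ 1)
    (E : ℝ → ℝ → ℝ) (hE : VFP.ElectricFieldCond E C_E lam C_s)
    (ha : 4 * C_E / (3 * C_s - 2 * C_E) < a) (ha' : a < (lam - C_E) / 4)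
    (K : Matrix (Fin 2) (Fin 2) ℝ)
    (f₀ : ℝ → ℝ → ℝ) (hmass : ∫ p in VFP.phaseSpace, f₀ p.1 p.2 = 0)
    (h : ℝ → ℝ → ℝ → ℝ)
    (hsol : VFP.IsSolution ε E K (fun x v => f₀ x v / √(VFP.maxwellian v)) h) :
    0 < VFP.rate ε a C_E lam C_s ∧
    ∀ t : ℝ, 0 < t →
      DifferentiableAt ℝ (VFP.lyapunov ε a h) t ∧
      deriv (VFP.lyapunov ε a h) t + VFP.rate ε a C_E lam C_s * VFP.normVSq (h t) ≤
        - (1 / ε * ∫ v : ℝ, v / 2 * (h t 1 v ^ 2 - h t 0 v ^ 2))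
        - (1 / ε * ∫ v : ℝ, v / 2 * (VFP.partialX (h t) 1 v ^ 2 - VFP.partialX (h t) 0 v ^ 2))
        - a * (VFP.flux (h t) 1 * VFP.dx (VFP.flux (h t)) 1
            - VFP.flux (h t) 0 * VFP.dx (VFP.flux (h t)) 0)
        + a * C_s / (2 * ε ^ 2)
          * (∫ s in (0 : ℝ)..t, (VFP.flux (h s) 1 - VFP.flux (h s) 0)) ^ 2 := by
  have hCE0 : 0 ≤ C_E := by
    have := (abs_nonneg _).trans (hE.bound 0 le_rfl 0 (left_mem_Icc.2 zero_le_one))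
    linarith
  -- From C_E ≤ lam·C_s/8 and lam ≤ 1/4. This makes the denominator in the lower bound for a
  -- positive and gives c = C_E/2 ≤ 1/64.
  have hCE : C_E ≤ C_s / 32 := by nlinarith [hE.small]
  have hden : 0 < 3 * C_s - 2 * C_E := by linarith
  have ha0 : 0 < a := (by positivity : 0 ≤ 4 * C_E / (3 * C_s - 2 * C_E)).trans_lt ha
  have ha1 := (div_lt_iff₀ hden).1 ha
  refine ⟨lt_min (div_pos (by linarith) (by positivity)) (by linarith), fun t ht => ?_⟩
  have hh := hsol.regular
  obtain ⟨B, hB, hτ, hI, hd⟩ := hh.exists_dominatedAt_nhds ht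
  have hdt := hd t (mem_of_mem_nhds hI)
  have hderiv := hh.hasDerivAt_lyapunov hB hτ hd ε a hI
  refine ⟨hderiv.differentiableAt, ?_⟩
  set ξ := VFP.rate ε a C_E lam C_s
  -- The pointwise estimate is used with c = C_E/2, the bound on E and ∂ₓE.
  have hξ1 : ξ ≤ (lam - 2 * (C_E / 2) - 4 * a) / ε ^ 2 :=
    (min_le_left _ _).trans_eq (by ring)
  have hξ2 : ξ ≤ (a * (3 * C_s - 4 * (C_E / 2)) - 8 * (C_E / 2)) / 8 :=
    (min_le_right _ _).trans_eq (by ring)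
  have s1 := hdt.slice_val hh ht
  have s2 := hdt.slice_dx hh ht
  have cN := (s1.continuousOn_integral hB hB s1).add (s2.continuousOn_integral hB hB s2)
  have cL := hdt.continuousOn_lyapunovDensityDt hh ht hB ε a
  have cQ := hdt.continuousOn_boundaryFluxDx hh ht hB ε a
  have cσ := s1.continuousOn_density hB
  have cσ' := s2.continuousOn_density hB
  have iL := cL.intervalIntegrable_of_Icc zero_le_one (μ := volume)
  have iN : IntervalIntegrable (fun x => ξ * ((∫ v, h t x v * h t x v)
      + ∫ v, VFP.partialX (h t) x v * VFP.partialX (h t) x v)) volume 0 1 :=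
    (continuousOn_const.mul cN).intervalIntegrable_of_Icc zero_le_one
  have iQ : IntervalIntegrable (fun x => -VFP.boundaryFluxDx ε a h t x) volume 0 1 :=
    cQ.neg.intervalIntegrable_of_Icc zero_le_one
  have iσ : IntervalIntegrable (fun x => VFP.density (h t) x ^ 2) volume 0 1 :=
    (cσ.pow 2).intervalIntegrable_of_Icc zero_le_one
  have iσ' : IntervalIntegrable (fun x => VFP.density (VFP.partialX (h t)) x ^ 2) volume 0 1 :=
    (cσ'.pow 2).intervalIntegrable_of_Icc zero_le_one
  have iP : IntervalIntegrable (fun x => a * C_s / 2 *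
      (VFP.density (h t) x ^ 2 - VFP.density (VFP.partialX (h t)) x ^ 2)) volume 0 1 :=
    (iσ.sub iσ').const_mul _
  -- Integration needs the pointwise estimate only for 0 < x < 1, where the equation holds.
  have hmono := intervalIntegral.integral_mono_on_of_le_Ioo zero_le_one (iL.add iN) (iQ.add iP)
    fun x hx => hsol.lyapunovDensityDt_add_le hε hε' (hE.smooth t ht.le) hB hdt ht hx ha0.le
      (by linarith) (by linarith) hlam' hCs.le hCs' (by linarith) hξ1 hξ2
      (hE.bound t ht.le x (Ioo_subset_Icc_self hx))
      (hE.bound_one t ht.le x (Ioo_subset_Icc_self hx))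
  rw [intervalIntegral.integral_add iL iN, intervalIntegral.integral_add iQ iP,
    intervalIntegral.integral_const_mul, intervalIntegral.integral_const_mul,
    intervalIntegral.integral_neg, intervalIntegral.integral_sub iσ iσ',
    hdt.integral_boundaryFluxDx hh ht hB, ← hdt.normVSq_eq hh ht hB, ← hderiv.deriv] at hmono
  -- The term aC_s/2·∫(σ² - (∂ₓσ)²) left by the pointwise estimate is at most aC_s/2 times the
  -- squared mass.
  have hpoin := VFP.poincare_unitInterval (fun x hx => hdt.hasDerivWithinAt_density hh ht hB hx) cσ'
  have hm := hsol.mass_eq hε ht (by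
    rw [← hmass]
    congr 1
    ext p
    exact div_mul_cancel₀ _ (VFP.sqrtM_pos p.2).ne')
  rw [hm] at hpoin
  have hp2 := mul_le_mul_of_nonneg_left hpoin (by positivity : 0 ≤ a * C_s / 2)
  have hlast : a * C_s / (2 * ε ^ 2) * (∫ s in (0 : ℝ)..t, (VFP.flux (h s) 1 - VFP.flux (h s) 0)) ^ 2
      = a * C_s / 2 * (-(1 / ε) * ∫ s in (0 : ℝ)..t, (VFP.flux (h s) 1 - VFP.flux (h s) 0)) ^ 2 := by
    field_simp
  rw [hlast]
  linarith
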